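/- For a probability measure $\rho$ on $\mathbb R$ let $G_\rho(z)=\int \frac{\rho(dx)}{z-x}$, $F_\rho=1/G_\rho$ on the upper half-plane, and let $V_\rho(z)=F_\rho^{-1}(z)-z$ be its Voiculescu transform, where $F_\rho^{-1}$ is the inverse of the restriction of $F_\rho$ to a truncated cone $\{\operatorname{Im} z>\beta,\ |\operatorname{Re} z|<\alpha\operatorname{Im} z\}$. When $\rho$ is infinitely divisible for free additive convolution $\boxplus$ (for which $V_{\mu\boxplus\nu}=V_\mu+V_\nu$), $V_\rho$ is continued analytically to the whole upper half-plane. Let $(ID,\boxplus)$ be the class of all functions $t\mapsto V_\rho(it)$, $t>0$, with $\rho$ a $\boxplus$-infinitely divisible probability measure. For $k\ge 1$ put $\tau_k(t)=\frac1{(k-1)!}\int_0^t(-\log v)^{k-1}dv$, $0\le t\le 1$, and let $(\mathcal U^{<k>},\ast)$ be the class of the laws of the random integrals $$\int_{(0,1]}t\,dY(\tau_k(t)) := Y(\tau_k(1))-\int_0^1 Y(\tau_k(t))\,dt,$$ where $Y$ runs over all real càdlàg Lévy processes. Let $(\mathcal U^{<k>},\boxplus)$ be the class of all functions $t\mapsto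 V_{\tilde\nu}(it)$, $t>0$, where $\tilde\nu$ is the free-probability counterpart of some $\nu\in(\mathcal U^{<k>},\ast)$, that is, the $\boxplus$-infinitely divisible probability measure with $$V_{\tilde\nu}(it)=it^2\int_0^\infty \log\phi_\nu(-u)\,e^{-tu}\,du,\qquad t>0,$$ $\phi_\nu$ being the characteristic function of $\nu$ and $\log\phi_\nu$ its continuous logarithm vanishing at $0$. Put $(\mathcal U^{<0>},\boxplus):=(ID,\boxplus)$. Define $\mathbb D f(t):=2f(t)-t\frac{d}{dt}f(t)$, $t>0$. Then for every $k\ge1$ all functions in $(\mathcal U^{<k>},\boxplus)$ are differentiable on $(0,\infty)$ and $$\mathbb D:(\mathcal U^{<k>},\boxplus)\to(\mathcal U^{<k-1>},\boxplus).$$ Hence $\mathbb D^k:(\mathcal U^{<k>},\boxplus)\to(ID,\boxplus)$ for every $k\ge1$. -/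

import Mathlib

open MeasureTheory ProbabilityTheory Set Filter Topology
open scoped NNReal

noncomputable section

/-! ### Lévy processes and random integrals -/

/-- A real-valued càdlàg Lévy process started at `0`: independent and stationary increments,
right-continuous paths with left limits. -/
structure IsLevyProcess {Ω : Type*} [MeasurableSpace Ω] (Y : ℝ≥0 → Ω → ℝ)
    (P : Measure Ω) : Prop where
  measurable : ∀ t, Measurable (Y t)
  zero : ∀ ω, Y 0 ω = 0
  indepIncrements : HasIndepIncrements Y P
  stationaryIncrements : ∀ s t : ℝ≥0,
    P.map (fun ω => Y (s + t) ω - Y s ω) = P.map (Y t)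
  rightContinuous : ∀ ω t, ContinuousWithinAt (fun s => Y s ω) (Ici t) t
  leftLimits : ∀ ω t, ∃ l : ℝ, Tendsto (fun s => Y s ω) (𝓝[<] t) (𝓝 l)

/-- The random integral `∫_{(a,b]} h(t) dY(r(t))` of a continuously differentiable `h` with respect
to a time-changed càdlàg process, defined pathwise through integration by parts:
`h(b) Y(r(b)) - h(a) Y(r(a)) - ∫_{(a,b]} Y(r(t)) dh(t)`. -/
def randomIntegral {Ω : Type*} (h : ℝ → ℝ) (r : ℝ → ℝ) (a b : ℝ) (Y : ℝ≥0 → Ω → ℝ) (ω : Ω) : ℝ :=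
  h b * Y (r b).toNNReal ω - h a * Y (r a).toNNReal ω
    - ∫ t in a..b, Y (r t).toNNReal ω * deriv h t

/-- The time change `τ_k(t) = (1/(k-1)!) ∫_0^t (-log v)^{k-1} dv` for `k ≥ 1`, `0 ≤ t ≤ 1`. -/
def tau (k : ℕ) (t : ℝ) : ℝ :=
  (1 / ((k - 1).factorial : ℝ)) * ∫ v in (0 : ℝ)..t, (-Real.log v) ^ (k - 1)

/-- The class `(𝒰^{<k>}, ∗)`, `k ≥ 1`, of `k`-times s-selfdecomposable probability measures:
the laws of the random integrals `∫_{(0,1]} t dY(τ_k(t))` over all Lévy processes `Y`. -/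
def classicalU (k : ℕ) : Set (Measure ℝ) :=
  {ν | ∃ (Ω : Type) (_ : MeasurableSpace Ω) (P : Measure Ω) (_ : IsProbabilityMeasure P)
      (Y : ℝ≥0 → Ω → ℝ), IsLevyProcess Y P ∧
        ν = P.map (randomIntegral (fun t => t) (tau k) 0 1 Y)}

/-- `ψ = log φ_ν`: the continuous logarithm, vanishing at `0`, of the characteristic function
of `ν`. It is unique when it exists, and it exists for infinitely divisible `ν`. -/
def IsLogCharFun (ν : Measure ℝ) (ψ : ℝ → ℂ) : Prop :=
  Continuous ψ ∧ ψ 0 = 0 ∧ ∀ t, charFun ν t = Complex.exp (ψ t)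

/-! ### Voiculescu transforms and free infinite divisibility -/

/-- The reciprocal Cauchy transform `F_ρ(z) = 1 / G_ρ(z)`, `G_ρ(z) = ∫ 1/(z - x) ρ(dx)`. -/
def reciprocalCauchy (ρ : Measure ℝ) (z : ℂ) : ℂ :=
  (∫ x : ℝ, 1 / (z - (x : ℂ)) ∂ρ)⁻¹

/-- The truncated cone `Γ_{α,β} = {z : Im z > β, |Re z| < α Im z}`. -/
def truncatedCone (α β : ℝ) : Set ℂ :=
  {z | β < z.im ∧ |z.re| < α * z.im}

/-- `V` is (an extension of) the Voiculescu transform `V_ρ(z) = F_ρ⁻¹(z) - z`, where `F_ρ⁻¹` is the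
inverse of the restriction of `F_ρ` to a truncated cone `Γ_{α,β}`. The values of `V` are
prescribed on `F_ρ(Γ_{α,β})`, which contains a truncated cone. -/
def IsVoiculescuTransform (ρ : Measure ℝ) (V : ℂ → ℂ) : Prop :=
  ∃ α > 0, ∃ β > 0, ∀ w ∈ truncatedCone α β,
    V (reciprocalCauchy ρ w) = w - reciprocalCauchy ρ w

/-- `ρ = μ_1 ⊞ ⋯ ⊞ μ_n`, free additive convolution: the Voiculescu transforms add up. -/
def IsFreeConvolution {n : ℕ} (μ : Fin n → Measure ℝ) (ρ : Measure ℝ) : Prop :=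
  ∃ V : Fin n → ℂ → ℂ, (∀ j, IsVoiculescuTransform (μ j) (V j)) ∧
    IsVoiculescuTransform ρ (fun z => ∑ j, V j z)

/-- A probability measure `ρ` on `ℝ` is freely infinitely divisible: for every `n ≥ 1` it is
the `n`-fold free additive convolution power of some probability measure. -/
def IsFreelyInfDiv (ρ : Measure ℝ) : Prop :=
  IsProbabilityMeasure ρ ∧ ∀ n : ℕ, 1 ≤ n →
    ∃ μ : Measure ℝ, IsProbabilityMeasure μ ∧ IsFreeConvolution (fun _ : Fin n => μ) ρ

/-- `f(t) = V_ρ(it)` for all `t > 0`, where `V_ρ` is the Voiculescu transform of `ρ`, continued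
analytically to the open upper half-plane. -/
def IsImaginaryAxisTransform (ρ : Measure ℝ) (f : ℝ → ℂ) : Prop :=
  ∃ V : ℂ → ℂ, DifferentiableOn ℂ V {z | 0 < z.im} ∧ IsVoiculescuTransform ρ V ∧
    ∀ t : ℝ, 0 < t → f t = V (Complex.I * t)

/-- `(ID, ⊞)`, as a class of transforms `f(t) = V_ρ(it)`, `t > 0`. -/
def freeID : Set (ℝ → ℂ) :=
  {f | ∃ ρ : Measure ℝ, IsFreelyInfDiv ρ ∧ IsImaginaryAxisTransform ρ f}

/-- `ρ` is the free-probability counterpart of the classical measure `ν`: it is freely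
infinitely divisible and `V_ρ(it) = i t² ∫_0^∞ log φ_ν(-u) e^{-tu} du` for `t > 0`. -/
def IsFreeCounterpart (ν ρ : Measure ℝ) : Prop :=
  IsFreelyInfDiv ρ ∧ ∃ ψ : ℝ → ℂ, IsLogCharFun ν ψ ∧
    IsImaginaryAxisTransform ρ (fun t =>
      Complex.I * (t : ℂ) ^ 2 * ∫ u in Ioi (0 : ℝ), ψ (-u) * Complex.exp (-(t * u : ℂ)))

/-- `(𝒰^{<k>}, ⊞)`, as a class of transforms `f(t) = V_ρ(it)`, `t > 0`: for `k ≥ 1` the `ρ` are the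
free-probability counterparts of the measures in `(𝒰^{<k>}, ∗)`, and
`(𝒰^{<0>}, ⊞) = (ID, ⊞)`. -/
def freeU : ℕ → Set (ℝ → ℂ)
  | 0 => freeID
  | k + 1 => {f | ∃ ν ∈ classicalU (k + 1), ∃ ρ : Measure ℝ,
      IsFreeCounterpart ν ρ ∧ IsImaginaryAxisTransform ρ f}

/-- The differential operator `𝔻 f(t) = 2 f(t) - t f'(t)`. -/
def opD (f : ℝ → ℂ) : ℝ → ℂ := fun t => 2 * f t - t * deriv f t

end

/-! Write `A f(u) = ∫_0^1 f(su) ds`. If `Ψ` is the Lévy exponent of `Y`, the law of `∫ t dY(τ_k(t))`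
has exponent `∫_0^1 Ψ(su) dτ_k(s)`, where `τ_k` has density `(-log s)^{k-1}/(k-1)!`. Integrating by
parts lowers the power of the logarithm and puts one average on `Ψ`, so this exponent is `A^k Ψ`
(`logWeightedAverage_eq_iterate`).

The transform attached to an exponent is `V_ψ(z) = -i z² ∫_0^∞ ψ(-u) e^{izu} du`. Since `u · Aχ(u)`
has derivative `χ(u)`, one more integration by parts shows that `𝔻` carries `V_{Aχ}` to `V_χ`
(`two_mul_voiculescu_radialAverage_sub`). Hence `𝔻` removes exactly one average, taking `A^k Ψ` to
`A^{k-1} Ψ`: the same process `Y` witnesses membership in the preceding class, and after the last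
average only `Ψ` is left.

Membership in the target also requires a freely infinitely divisible measure with transform `V_χ`.
This is the existence part of the Bercovici–Pata correspondence (`exists_isFreelyInfDiv`), and it
takes up the first half of the proof. The exponent `χ` is a limit of finite compound Poisson
exponents, whose transforms are rational Pick functions `W`. For such `W` the iteration `F ↦ w -
W(F)` stays among reciprocal Cauchy transforms of probability measures. Since `V_χ(iy) = o(y)`, the
measures arising this way are tight, and a limit point has Voiculescu transform `V_χ`. Free `n`-th
roots come from `χ / n`, because `χ ↦ V_χ` is linear.

Two uniqueness facts tie an arbitrary member of the class to this computation: the continuous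
logarithm of a characteristic function is unique (`IsLogCharFun.unique`), and so is the analytic
continuation of a Voiculescu transform (`IsImaginaryAxisTransform.eq`). -/

open scoped Interval

/-! ### Rational Pick functions -/

/-- `V` agrees on the upper half-plane with a rational function `c + ∑ a_j / (z - x_j)`,
`a_j ≥ 0`. -/
def IsFinitePick (V : ℂ → ℂ) : Prop :=
  ∃ (ι : Type) (_ : Fintype ι) (c : ℝ) (a x : ι → ℝ), (∀ j, 0 ≤ a j) ∧
    ∀ z : ℂ, 0 < z.im → V z = c + ∑ j, (a j : ℂ) / (z - x j)

theorem sub_ofReal_ne_zero {z : ℂ} (hz : 0 < z.im) (x : ℝ) : z - x ≠ 0 := by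
  intro h
  have := congrArg Complex.im h
  simp at this
  exact hz.ne' this

theorem im_ofReal_div_sub (a x : ℝ) (z : ℂ) :
    ((a : ℂ) / (z - x)).im = -(a * z.im / ((z.re - x) ^ 2 + z.im ^ 2)) := by
  rw [div_eq_mul_inv, Complex.im_ofReal_mul, Complex.inv_im, Complex.normSq_apply]
  simp only [Complex.sub_re, Complex.sub_im, Complex.ofReal_re, Complex.ofReal_im, sub_zero]
  ring

/-- The scalar spectral measure of a bordered diagonal Hermitian matrix. -/
theorem exists_sum_eq_inv {ι : Type} [Fintype ι] (c : ℝ) (a x : ι → ℝ) (ha : ∀ j, 0 ≤ a j) :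
    ∃ (κ : Type) (_ : Fintype κ) (p l : κ → ℝ), (∀ j, 0 ≤ p j) ∧ ∑ j, p j = 1 ∧
      ∀ w : ℂ, 0 < w.im →
        ∑ j, (p j : ℂ) / (w - l j) = (w - c - ∑ j, (a j : ℂ) / (w - x j))⁻¹ := by
  classical
  -- The arrow matrix with corner `c`, border `√a_i` and diagonal `x_i`: by the Schur complement,
  -- the corner entry of `(w - A)⁻¹` is the right-hand side, while the spectral theorem expands the
  -- same entry in partial fractions.
  let A : Matrix (Option ι) (Option ι) ℝ := Matrix.of fun k l => match k, l with
    | none, none => c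
    | none, some i => √(a i)
    | some i, none => √(a i)
    | some i, some j => if i = j then x i else 0
  have hA : A.IsHermitian := by
    ext k l
    rcases k with _ | k <;> rcases l with _ | l <;> simp [A]
    by_cases h : k = l
    · simp [h]
    · simp [h, Ne.symm h]
  let u : Option ι → Option ι → ℝ := fun j k => hA.eigenvectorBasis j k
  let l : Option ι → ℝ := hA.eigenvalues
  have heig : ∀ j k, ∑ m, A k m * u j m = l j * u j k := by
    intro j k
    have := congrFun (hA.mulVec_eigenvectorBasis j) k
    simpa [Matrix.mulVec, dotProduct] using this
  have hone : ∀ k m, ∑ j, u j k * u j m = if k = m then 1 else 0 := by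
    intro k m
    have := hA.eigenvectorBasis.sum_inner_mul_inner (EuclideanSpace.single k (1 : ℝ))
      (EuclideanSpace.single m (1 : ℝ))
    simp [EuclideanSpace.inner_single_left, EuclideanSpace.inner_single_right] at this
    simpa [u, eq_comm] using this
  refine ⟨Option ι, inferInstance, fun j => u j none * u j none, l, fun j => mul_self_nonneg _,
    by simpa using hone none none, fun w hw => ?_⟩
  -- The `none` column of the resolvent `(w - A)⁻¹`, written in the eigenbasis; `hv` says that `w -
  -- A` maps it to the basis vector at `none`.
  let v : Option ι → ℂ := fun k => ∑ j, (u j none : ℂ) * u j k / (w - l j)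
  have hv : ∀ k, w * v k - ∑ m, (A k m : ℂ) * v m = ((if none = k then 1 else 0 : ℝ) : ℂ) := by
    intro k
    have h1 : ∑ m, (A k m : ℂ) * v m = ∑ j, (u j none : ℂ) * (l j * u j k) / (w - l j) := by
      simp only [v, Finset.mul_sum]
      rw [Finset.sum_comm]
      refine Finset.sum_congr rfl fun j _ => ?_
      have := congrArg (fun r : ℝ => (r : ℂ)) (heig j k)
      push_cast at this
      rw [← this, Finset.mul_sum, Finset.sum_div]
      exact Finset.sum_congr rfl fun m _ => by ring
    rw [h1]
    simp only [v, Finset.mul_sum]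
    rw [← Finset.sum_sub_distrib]
    have h2 := congrArg (fun r : ℝ => (r : ℂ)) (hone none k)
    push_cast at h2
    rw [← h2]
    refine Finset.sum_congr rfl fun j _ => ?_
    have := sub_ofReal_ne_zero hw (l j)
    field_simp
  have hsome : ∀ i, v (some i) = √(a i) * v none / (w - x i) := by
    intro i
    have := hv (some i)
    simp [Fintype.sum_option, A, apply_ite (fun r : ℝ => (r : ℂ))] at this
    rw [eq_div_iff (sub_ofReal_ne_zero hw _)]
    linear_combination this
  have hnone := hv none
  simp only [Fintype.sum_option, A, hsome] at hnone
  simp only [Matrix.of_apply, if_true, Complex.ofReal_one] at hnone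
  have h3 : v none = ∑ j, ((u j none * u j none : ℝ) : ℂ) / (w - l j) := by simp [v]
  rw [← h3]
  refine eq_inv_of_mul_eq_one_left ?_
  rw [← hnone]
  have h4 : ∑ i, (√(a i) : ℂ) * (√(a i) * v none / (w - x i))
      = v none * ∑ j, (a j : ℂ) / (w - x j) := by
    rw [Finset.mul_sum]
    refine Finset.sum_congr rfl fun i _ => ?_
    have : (a i : ℂ) = √(a i) * √(a i) := by
      rw [← Complex.ofReal_mul, Real.mul_self_sqrt (ha i)]
    rw [this]
    ring
  rw [h4]
  ring

namespace IsFinitePick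

theorem congr {V W : ℂ → ℂ} (hV : IsFinitePick V) (h : ∀ z : ℂ, 0 < z.im → W z = V z) :
    IsFinitePick W := by
  obtain ⟨ι, i, c, a, x, ha, hx⟩ := hV
  exact ⟨ι, i, c, a, x, ha, fun z hz => (h z hz).trans (hx z hz)⟩

theorem const (c : ℝ) : IsFinitePick fun _ => (c : ℂ) :=
  ⟨Empty, inferInstance, c, fun _ => 0, fun _ => 0, fun _ => le_rfl, fun z _ => by simp⟩

theorem add {V W : ℂ → ℂ} (hV : IsFinitePick V) (hW : IsFinitePick W) :
    IsFinitePick fun z => V z + W z := by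
  obtain ⟨ι, _, c, a, x, ha, hx⟩ := hV
  obtain ⟨κ, _, d, b, y, hb, hy⟩ := hW
  refine ⟨ι ⊕ κ, inferInstance, c + d, Sum.elim a b, Sum.elim x y, ?_, fun z hz => ?_⟩
  · rintro (j | j)
    exacts [ha j, hb j]
  · simp only [hx z hz, hy z hz, Fintype.sum_sum_type, Sum.elim_inl, Sum.elim_inr]
    push_cast
    ring

theorem const_mul {V : ℂ → ℂ} (hV : IsFinitePick V) {r : ℝ} (hr : 0 ≤ r) :
    IsFinitePick fun z => r * V z := by
  obtain ⟨ι, _, c, a, x, ha, hx⟩ := hV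
  refine ⟨ι, inferInstance, r * c, fun j => r * a j, x, fun j => mul_nonneg hr (ha j),
    fun z hz => ?_⟩
  simp only [hx z hz, mul_add, Finset.mul_sum]
  push_cast
  simp only [mul_div_assoc]

theorem sum {ι : Type*} (s : Finset ι) {V : ι → ℂ → ℂ} (hV : ∀ j ∈ s, IsFinitePick (V j)) :
    IsFinitePick fun z => ∑ j ∈ s, V j z := by
  classical
  induction s using Finset.induction_on with
  | empty => simpa using const 0
  | insert j s hj ih =>
    simp only [Finset.sum_insert hj]
    exact (hV j (by simp)).add (ih fun i hi => hV i (by simp [hi]))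

theorem im_nonpos {V : ℂ → ℂ} (hV : IsFinitePick V) {z : ℂ} (hz : 0 < z.im) : (V z).im ≤ 0 := by
  obtain ⟨ι, _, c, a, x, ha, hx⟩ := hV
  rw [hx z hz]
  simp only [Complex.add_im, Complex.ofReal_im, zero_add, Complex.im_sum]
  refine Finset.sum_nonpos fun j _ => ?_
  rw [im_ofReal_div_sub]
  have := ha j
  exact neg_nonpos.2 (by positivity)

/-- Subtracting a real `x` only shifts the constant of `w - F w`, so the bordered matrix again gives
a partial fraction expansion with nonnegative weights. -/
theorem inv_sub {F : ℂ → ℂ} (hF : IsFinitePick fun w => w - F w) (x : ℝ) :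
    IsFinitePick fun w => (F w - x)⁻¹ := by
  obtain ⟨ι, _, c, a, y, ha, hy⟩ := hF
  obtain ⟨κ, _, p, l, hp, -, h⟩ := exists_sum_eq_inv (c + x) a y ha
  refine ⟨κ, inferInstance, 0, p, l, hp, fun w hw => ?_⟩
  rw [Complex.ofReal_zero, zero_add, h w hw]
  refine congrArg Inv.inv ?_
  have := hy w hw
  simp only at this
  push_cast
  linear_combination -this

theorem im_le_im {F : ℂ → ℂ} (hF : IsFinitePick fun w => w - F w) {w : ℂ} (hw : 0 < w.im) :
    w.im ≤ (F w).im := by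
  have := hF.im_nonpos hw
  simp only [Complex.sub_im] at this
  linarith

/-- The closure property behind the iteration `F ↦ w - V F`. Such an `F` does not decrease imaginary
parts, so it preserves the half-plane, and each pole term of `V` turns into a `(F - x)⁻¹`. -/
theorem comp {V F : ℂ → ℂ} (hV : IsFinitePick V) (hF : IsFinitePick fun w => w - F w) :
    IsFinitePick fun w => V (F w) := by
  obtain ⟨ι, _, c, a, x, ha, hx⟩ := hV
  refine ((const c).add (sum Finset.univ fun j _ => (hF.inv_sub (x j)).const_mul (ha j))).congr
    fun w hw => ?_
  rw [hx _ (hw.trans_le (hF.im_le_im hw))]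
  simp [div_eq_mul_inv]

/-- `F` is the reciprocal Cauchy transform of a probability measure if `w - F w` is a rational
Pick function. -/
theorem exists_cauchyTransform {F : ℂ → ℂ} (hF : IsFinitePick fun w => w - F w) :
    ∃ ρ : Measure ℝ, IsProbabilityMeasure ρ ∧
      ∀ w : ℂ, 0 < w.im → ∫ x : ℝ, 1 / (w - (x : ℂ)) ∂ρ = (F w)⁻¹ := by
  obtain ⟨ι, _, c, a, y, ha, hy⟩ := hF
  obtain ⟨κ, _, p, l, hp, hp1, h⟩ := exists_sum_eq_inv c a y ha
  refine ⟨∑ j, ENNReal.ofReal (p j) • Measure.dirac (l j), ⟨?_⟩, fun w hw => ?_⟩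
  · simp only [Measure.coe_finsetSum, Finset.sum_apply, Measure.smul_apply, measure_univ,
      smul_eq_mul, mul_one]
    rw [← ENNReal.ofReal_sum_of_nonneg fun j _ => hp j, hp1, ENNReal.ofReal_one]
  · rw [integral_finsetSum_measure]
    · simp only [integral_smul_measure, integral_dirac, ENNReal.toReal_ofReal (hp _)]
      have : F w = w - c - ∑ j, (a j : ℂ) / (w - y j) := by linear_combination -(hy w hw)
      rw [this, ← h w hw]
      simp [div_eq_mul_inv]
    · intro j _
      exact (integrable_dirac (by simp)).smul_measure (by simp)

/-- A rational Pick function is Lipschitz on truncated cones, with a constant given by its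
imaginary part at a single point. -/
theorem norm_sub_le {V : ℂ → ℂ} (hV : IsFinitePick V) {y : ℝ} (hy : 0 < y) {z w : ℂ}
    (hz : y ≤ z.im) (hz' : |z.re| ≤ z.im) (hw : y ≤ w.im) (hw' : |w.re| ≤ w.im) :
    ‖V z - V w‖ ≤ 3 * (-(V (Complex.I * y)).im / y) * ‖z - w‖ := by
  obtain ⟨ι, _, c, a, x, ha, hx⟩ := hV
  have hI : 0 < (Complex.I * (y : ℂ)).im := by simpa using hy
  -- Source of the constant 3: on the cone `z.re² ≤ z.im²` and `y² ≤ z.im²`, whence `x² + y² ≤ 3 ‖z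
  -- - x‖²`. The square-root form lets the bounds for `z` and `w` be multiplied.
  have key : ∀ z : ℂ, y ≤ z.im → |z.re| ≤ z.im → ∀ x : ℝ,
      √(x ^ 2 + y ^ 2) ≤ √3 * ‖z - x‖ := by
    intro z h1 h2 x
    rw [Complex.norm_def, ← Real.sqrt_mul (by norm_num)]
    apply Real.sqrt_le_sqrt
    rw [Complex.normSq_apply]
    simp only [Complex.sub_re, Complex.sub_im, Complex.ofReal_re, Complex.ofReal_im, sub_zero]
    have h3 : z.re ^ 2 ≤ z.im ^ 2 := sq_le_sq' (by linarith [neg_abs_le z.re])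
      (by linarith [le_abs_self z.re])
    have h4 : y ^ 2 ≤ z.im ^ 2 := by gcongr
    nlinarith [sq_nonneg (x - 2 * z.re)]
  have hA : -(V (Complex.I * y)).im / y = ∑ j, a j / (x j ^ 2 + y ^ 2) := by
    rw [hx _ hI]
    simp only [Complex.add_im, Complex.ofReal_im, zero_add, Complex.im_sum]
    rw [← Finset.sum_neg_distrib, Finset.sum_div]
    refine Finset.sum_congr rfl fun j _ => ?_
    rw [im_ofReal_div_sub]
    simp only [Complex.mul_re, Complex.mul_im, Complex.I_re, Complex.I_im, Complex.ofReal_re,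
      Complex.ofReal_im]
    field_simp
    ring
  rw [hA, hx z (hy.trans_le hz), hx w (hy.trans_le hw), add_sub_add_left_eq_sub,
    ← Finset.sum_sub_distrib, Finset.mul_sum, Finset.sum_mul]
  refine (norm_sum_le _ _).trans (Finset.sum_le_sum fun j _ => ?_)
  have hz0 := sub_ofReal_ne_zero (hy.trans_le hz) (x j)
  have hw0 := sub_ofReal_ne_zero (hy.trans_le hw) (x j)
  have h1 : (a j : ℂ) / (z - x j) - a j / (w - x j)
      = a j * (w - z) / ((z - x j) * (w - x j)) := by
    field_simp
    ring
  rw [h1, norm_div, norm_mul, norm_mul, Complex.norm_real, Real.norm_of_nonneg (ha j),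
    norm_sub_rev w z]
  have h2 := mul_le_mul (key z hz hz' (x j)) (key w hw hw' (x j)) (Real.sqrt_nonneg _)
    (by positivity)
  rw [Real.mul_self_sqrt (by positivity)] at h2
  have h3 : √3 * ‖z - x j‖ * (√3 * ‖w - x j‖) = 3 * (‖z - x j‖ * ‖w - x j‖) := by
    linear_combination (‖z - x j‖ * ‖w - x j‖) * Real.mul_self_sqrt (show (0 : ℝ) ≤ 3 by norm_num)
  rw [h3] at h2
  have hz1 : 0 < ‖z - x j‖ := norm_pos_iff.2 hz0
  have hw1 : 0 < ‖w - x j‖ := norm_pos_iff.2 hw0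
  have h5 : 0 < x j ^ 2 + y ^ 2 := by positivity
  rw [div_le_iff₀ (by positivity)]
  calc a j * ‖z - w‖ = a j / (x j ^ 2 + y ^ 2) * ‖z - w‖ * (x j ^ 2 + y ^ 2) := by
        field_simp
    _ ≤ a j / (x j ^ 2 + y ^ 2) * ‖z - w‖ * (3 * (‖z - x j‖ * ‖w - x j‖)) := by
        have := ha j
        gcongr
    _ = _ := by ring

end IsFinitePick

/-! ### Cauchy transforms -/

/-- The Cauchy kernel `x ↦ 1 / (w - x)` as a bounded continuous function. -/
noncomputable def cauchyKernel (w : ℂ) (hw : 0 < w.im) : BoundedContinuousFunction ℝ ℂ :=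
  BoundedContinuousFunction.ofNormedAddCommGroup (fun x : ℝ => 1 / (w - (x : ℂ)))
    (continuous_const.div (by fun_prop) fun x => sub_ofReal_ne_zero hw x) w.im⁻¹ (by
      intro x
      rw [norm_div, norm_one, one_div]
      refine inv_anti₀ hw ?_
      simpa [abs_of_pos hw] using Complex.abs_im_le_norm (w - (x : ℂ)))

theorem integrable_cauchyKernel (ρ : Measure ℝ) [IsFiniteMeasure ρ] {w : ℂ} (hw : 0 < w.im) :
    Integrable (fun x : ℝ => 1 / (w - (x : ℂ))) ρ :=
  (cauchyKernel w hw).integrable ρ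

theorem im_one_div_sub_neg {w : ℂ} (hw : 0 < w.im) (x : ℝ) : (1 / (w - (x : ℂ))).im < 0 := by
  have := im_ofReal_div_sub 1 x w
  rw [Complex.ofReal_one] at this
  rw [this]
  exact neg_lt_zero.2 (by positivity)

theorem im_cauchyTransform_neg (ρ : Measure ℝ) [IsProbabilityMeasure ρ] {w : ℂ} (hw : 0 < w.im) :
    (∫ x : ℝ, 1 / (w - (x : ℂ)) ∂ρ).im < 0 := by
  have hi := integrable_cauchyKernel ρ hw
  have h : (∫ x : ℝ, 1 / (w - (x : ℂ)) ∂ρ).im = ∫ x : ℝ, (1 / (w - (x : ℂ))).im ∂ρ :=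
    (integral_im hi).symm
  rw [h, ← neg_pos, ← integral_neg]
  rw [integral_pos_iff_support_of_nonneg (fun x => (neg_pos.2 (im_one_div_sub_neg hw x)).le)
    hi.im.neg]
  have : Function.support (fun x : ℝ => -(1 / (w - (x : ℂ))).im) = univ := by
    ext x
    simpa using (im_one_div_sub_neg hw x).ne
  rw [this]
  simp

theorem cauchyTransform_ne_zero (ρ : Measure ℝ) [IsProbabilityMeasure ρ] {w : ℂ}
    (hw : 0 < w.im) : ∫ x : ℝ, 1 / (w - (x : ℂ)) ∂ρ ≠ 0 := fun h => by
  have := im_cauchyTransform_neg ρ hw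
  rw [h] at this
  simp at this

theorem im_reciprocalCauchy_pos (ρ : Measure ℝ) [IsProbabilityMeasure ρ] {w : ℂ}
    (hw : 0 < w.im) : 0 < (reciprocalCauchy ρ w).im := by
  rw [reciprocalCauchy, Complex.inv_im]
  exact div_pos (neg_pos.2 (im_cauchyTransform_neg ρ hw))
    (Complex.normSq_pos.2 (cauchyTransform_ne_zero ρ hw))

/-- Tail estimate by the Cauchy transform on the imaginary axis. -/
theorem measureReal_tail_le (ρ : Measure ℝ) [IsProbabilityMeasure ρ] {y : ℝ} (hy : 0 < y) :
    ρ.real {x : ℝ | y < ‖x‖} ≤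
      2 * ‖1 - Complex.I * y * ∫ x : ℝ, 1 / (Complex.I * y - (x : ℂ)) ∂ρ‖ := by
  have hI : 0 < (Complex.I * (y : ℂ)).im := by simpa using hy
  have hi := (integrable_cauchyKernel ρ hI).const_mul (Complex.I * y)
  have hi2 : Integrable (fun x : ℝ => 1 - Complex.I * y * (1 / (Complex.I * y - (x : ℂ)))) ρ :=
    (integrable_const _).sub hi
  have hm : MeasurableSet {x : ℝ | y < ‖x‖} := measurableSet_lt measurable_const measurable_norm
  have h1 : 1 - Complex.I * y * ∫ x : ℝ, 1 / (Complex.I * y - (x : ℂ)) ∂ρ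
      = ∫ x : ℝ, 1 - Complex.I * y * (1 / (Complex.I * y - (x : ℂ))) ∂ρ := by
    rw [integral_sub (integrable_const _) hi, integral_const_mul]
    simp
  rw [h1]
  -- This ratio is at least `1/2` once `|x| > y`, which explains the factor 2.
  have h2 : ∀ x : ℝ, (1 - Complex.I * y * (1 / (Complex.I * y - (x : ℂ)))).re
      = x ^ 2 / (x ^ 2 + y ^ 2) := by
    intro x
    have : Complex.I * (y : ℂ) * (1 / (Complex.I * y - (x : ℂ)))
        = (y : ℂ) * (Complex.I * (Complex.I * y - (x : ℂ))⁻¹) := by ring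
    have hpos : x ^ 2 + y ^ 2 ≠ 0 := by positivity
    rw [this, Complex.sub_re, Complex.re_ofReal_mul]
    simp only [Complex.mul_re, Complex.I_re, Complex.I_im, Complex.inv_re, Complex.inv_im,
      Complex.normSq_apply, Complex.sub_re, Complex.sub_im, Complex.mul_im, Complex.ofReal_re,
      Complex.ofReal_im, Complex.one_re]
    have h' : (0 * y - 1 * 0 - x) * (0 * y - 1 * 0 - x)
      + (0 * 0 + 1 * y - 0) * (0 * 0 + 1 * y - 0) = x ^ 2 + y ^ 2 := by ring
    rw [h']
    field_simp
    ring
  calc ρ.real {x : ℝ | y < ‖x‖}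
      = ∫ x, {x : ℝ | y < ‖x‖}.indicator (fun _ => (1 : ℝ)) x ∂ρ := by
        rw [integral_indicator hm]; simp
    _ ≤ ∫ x : ℝ, 2 * (1 - Complex.I * y * (1 / (Complex.I * y - (x : ℂ)))).re ∂ρ := by
        refine integral_mono ((integrable_const _).indicator hm) (hi2.re.const_mul 2) fun x => ?_
        simp only [h2]
        by_cases hx : y < ‖x‖
        · rw [indicator_of_mem (by exact hx)]
          have : y ^ 2 ≤ x ^ 2 := by
            rw [← sq_abs x]
            rw [Real.norm_eq_abs] at hx
            gcongr
          rw [← mul_div_assoc, le_div_iff₀ (by positivity)]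
          linarith
        · rw [indicator_of_notMem (by exact hx)]
          positivity
    _ = 2 * (∫ x : ℝ, 1 - Complex.I * y * (1 / (Complex.I * y - (x : ℂ))) ∂ρ).re := by
        rw [integral_const_mul]
        congr 1
        exact integral_re hi2
    _ ≤ _ := by
        gcongr
        exact Complex.re_le_norm _

/-! ### Inversion of `z + V z` -/

/-- The iterates approximating the right inverse `F` of `z + V z` by `F ↦ w - V F`. -/
def pickIterate (V : ℂ → ℂ) : ℕ → ℂ → ℂ
  | 0 => fun w => w
  | k + 1 => fun w => w - V (pickIterate V k w)

theorem IsFinitePick.sub_pickIterate {V : ℂ → ℂ} (hV : IsFinitePick V) (k : ℕ) :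
    IsFinitePick fun w => w - pickIterate V k w := by
  induction k with
  | zero => simpa [pickIterate] using IsFinitePick.const 0
  | succ k ih => simpa [pickIterate] using hV.comp ih

/-- Points near the narrow cone `|re| ≤ im / 2` remain in the wide cone `|re| ≤ im` where the
Lipschitz bound holds: a displacement of at most `w.im / 8` leaves `|z.re| ≤ 5/8 w.im` and `z.im ≥
7/8 w.im`. -/
theorem cone_of_norm_sub_le {y ε : ℝ} {w z : ℂ} (hy : 0 < y) (hε : ε ≤ 1 / 32)
    (hw : 2 * y ≤ w.im) (hw' : |w.re| ≤ w.im / 2) (hz : ‖z - w‖ ≤ 4 * ε * w.im) :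
    y ≤ z.im ∧ |z.re| ≤ z.im ∧ ‖z - Complex.I * y‖ ≤ 2 * w.im := by
  have hr : 4 * ε * w.im ≤ w.im / 8 := by nlinarith
  have h1 := (Complex.abs_re_le_norm (z - w)).trans (hz.trans hr)
  have h2 := (Complex.abs_im_le_norm (z - w)).trans (hz.trans hr)
  rw [Complex.sub_re] at h1
  rw [Complex.sub_im] at h2
  rw [abs_le] at h1 h2 hw'
  have h3 : |z.re| ≤ 5 / 8 * w.im := abs_le.2 ⟨by linarith, by linarith⟩
  refine ⟨by linarith, by linarith, (Complex.norm_le_abs_re_add_abs_im _).trans ?_⟩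
  have h4 : (z - Complex.I * y).re = z.re := by simp
  have h5 : (z - Complex.I * y).im = z.im - y := by simp
  rw [h4, h5, abs_of_nonneg (by linarith : 0 ≤ z.im - y)]
  linarith

/-- A contraction argument with constants read off at the single point `iy`. On the relevant ball
`‖V‖ ≤ 2ε w.im + M ≤ 3ε w.im`, so the iterates never leave it; there `V` has Lipschitz constant at
most `ε ≤ 1/2`, so successive differences halve. The bounds depend on `V` only through `ε` and `M`,
hence are uniform along a convergent sequence. -/
theorem IsFinitePick.norm_pickIterate {V : ℂ → ℂ} (hV : IsFinitePick V) {y ε M : ℝ} {w : ℂ}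
    (hy : 0 < y) (hε : ε ≤ 1 / 32)
    (hA : 3 * (-(V (Complex.I * y)).im / y) ≤ ε) (hM : ‖V (Complex.I * y)‖ ≤ M)
    (hw : 2 * y ≤ w.im) (hw' : |w.re| ≤ w.im / 2) (hMw : M ≤ ε * w.im) :
    (∀ k, ‖pickIterate V k w - w‖ ≤ 4 * ε * w.im) ∧
      ∀ k, ‖pickIterate V (k + 1) w - pickIterate V k w‖ ≤ (1 / 2) ^ k * w.im := by
  have hw0 : 0 < w.im := by linarith
  have hε0 : 0 ≤ ε := by
    have := (norm_nonneg _).trans (hM.trans hMw)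
    nlinarith
  have hIy : (Complex.I * (y : ℂ)).im = y := by simp
  have hIy' : (Complex.I * (y : ℂ)).re = 0 := by simp
  have hV1 : ∀ z, ‖z - w‖ ≤ 4 * ε * w.im → ‖V z‖ ≤ 3 * ε * w.im := by
    intro z hz
    obtain ⟨h1, h2, h3⟩ := cone_of_norm_sub_le hy hε hw hw' hz
    have h4 := hV.norm_sub_le hy h1 h2 (w := Complex.I * y) hIy.ge (by rw [hIy, hIy']; simpa using hy.le)
    have h5 : ‖V z‖ ≤ ‖V z - V (Complex.I * y)‖ + ‖V (Complex.I * y)‖ := by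
      simpa using norm_add_le (V z - V (Complex.I * y)) (V (Complex.I * y))
    have h6 : 3 * (-(V (Complex.I * y)).im / y) * ‖z - Complex.I * y‖ ≤ ε * (2 * w.im) :=
      mul_le_mul hA h3 (norm_nonneg _) hε0
    linarith
  have hball : ∀ k, ‖pickIterate V k w - w‖ ≤ 4 * ε * w.im := by
    intro k
    induction k with
    | zero => simp only [pickIterate, sub_self, norm_zero]; positivity
    | succ k ih =>
      have := hV1 _ ih
      simp only [pickIterate, sub_sub_cancel_left, norm_neg]
      nlinarith
  refine ⟨hball, fun k => ?_⟩
  induction k with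
  | zero =>
    have := hball 1
    simp only [pickIterate, pow_zero, one_mul] at this ⊢
    nlinarith
  | succ k ih =>
    obtain ⟨h1, h2, -⟩ := cone_of_norm_sub_le hy hε hw hw' (hball k)
    obtain ⟨h1', h2', -⟩ := cone_of_norm_sub_le hy hε hw hw' (hball (k + 1))
    have h4 := hV.norm_sub_le hy h1 h2 h1' h2'
    have h5 : pickIterate V (k + 1 + 1) w - pickIterate V (k + 1) w
        = V (pickIterate V k w) - V (pickIterate V (k + 1) w) := by
      simp only [pickIterate]; ring
    rw [h5, pow_succ]
    refine h4.trans ?_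
    rw [norm_sub_rev]
    calc _ ≤ (1 / 2) * ‖pickIterate V (k + 1) w - pickIterate V k w‖ := by
          gcongr; linarith
      _ ≤ (1 / 2) * ((1 / 2) ^ k * w.im) := by gcongr
      _ = _ := by ring

/-- A diagonal argument: the `m`-th iterate for `W m` is the reciprocal Cauchy transform of some `ρ
m`. The uniform control makes these measures tight, and for a limit point `Q` the relation `F_{k+1}
= w - W(F_k)` passes to the limit `V(F_Q(w)) = w - F_Q(w)`. -/
theorem exists_isVoiculescuTransform_of_tendsto {V : ℂ → ℂ} {W : ℕ → ℂ → ℂ}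
    (hW : ∀ m, IsFinitePick (W m))
    (hlim : ∀ z : ℂ, 0 < z.im → Tendsto (fun m => W m z) atTop (𝓝 (V z)))
    (hV : Tendsto (fun y : ℝ => V (Complex.I * y) / y) atTop (𝓝 0)) :
    ∃ ρ : Measure ℝ, IsProbabilityMeasure ρ ∧ IsVoiculescuTransform ρ V := by
  have hI : ∀ {y : ℝ}, 0 < y → 0 < (Complex.I * (y : ℂ)).im := fun hy => by simpa using hy
  -- uniform control of the approximants from their values at one point
  have hctl : ∀ ε : ℝ, 0 < ε → ∃ y : ℝ, 0 < y ∧ ∃ M : ℝ, ∀ᶠ m in atTop,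
      3 * (-(W m (Complex.I * y)).im / y) ≤ ε ∧ ‖W m (Complex.I * y)‖ ≤ M := by
    intro ε hε
    have h1 : ∀ᶠ y : ℝ in atTop, ‖V (Complex.I * y) / y‖ < ε / 3 := by
      have := hV.norm
      rw [norm_zero] at this
      exact this.eventually_lt_const (by positivity)
    obtain ⟨y, hy, hy0⟩ := (h1.and (eventually_gt_atTop 0)).exists
    refine ⟨y, hy0, ‖V (Complex.I * y)‖ + 1, ?_⟩
    have h2 := hlim _ (hI hy0)
    have h3 : Tendsto (fun m => 3 * (-(W m (Complex.I * y)).im / y)) atTop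
        (𝓝 (3 * (-(V (Complex.I * y)).im / y))) :=
      (((Complex.continuous_im.tendsto _).comp h2).neg.div_const y).const_mul 3
    have h4 : 3 * (-(V (Complex.I * y)).im / y) < ε := by
      rw [norm_div, Complex.norm_real, Real.norm_of_nonneg hy0.le, div_lt_iff₀ hy0] at hy
      have := (neg_le_abs _).trans (Complex.abs_im_le_norm (V (Complex.I * y)))
      rw [← mul_div_assoc, div_lt_iff₀ hy0]
      linarith
    filter_upwards [h3.eventually_lt_const h4, h2.norm.eventually_lt_const (lt_add_one _)]
      with m hm hm' using ⟨hm.le, hm'.le⟩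
  choose ρ hρ hρG using fun m => ((hW m).sub_pickIterate m).exists_cauchyTransform
  have htight : IsTightMeasureSet (range ρ) := by
    refine isTightMeasureSet_range_of_tendsto_limsup_measure_norm_gt ?_
    rw [ENNReal.tendsto_nhds_zero]
    intro η hη
    obtain ⟨δ, hδ, hδη⟩ : ∃ δ : ℝ, 0 < δ ∧ ENNReal.ofReal δ ≤ η := by
      rcases eq_or_ne η ⊤ with rfl | h
      · exact ⟨1, one_pos, le_top⟩
      · exact ⟨η.toReal, ENNReal.toReal_pos hη.ne' h, ENNReal.ofReal_toReal_le⟩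
    -- `1/32` is what the cone estimates need; `δ/16` turns `‖F - ir‖ ≤ 4εr` and `‖F‖ ≥ 7r/8` into a
    -- ratio of at most `δ/2`, which the tail estimate doubles.
    set ε : ℝ := min (1 / 32) (δ / 16) with hεdef
    have hε : 0 < ε := by positivity
    have hε1 : ε ≤ 1 / 32 := min_le_left _ _
    have hε2 : ε ≤ δ / 16 := min_le_right _ _
    obtain ⟨y, hy, M, hM⟩ := hctl ε hε
    filter_upwards [eventually_ge_atTop (max (2 * y) (M / ε))] with r hr
    have hr1 : 2 * y ≤ r := (le_max_left _ _).trans hr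
    have hr2 : M ≤ ε * r := by
      have := (le_max_right _ _).trans hr
      rwa [div_le_iff₀ hε, mul_comm] at this
    have hr0 : 0 < r := by linarith
    refine limsup_le_of_le (by isBoundedDefault) ?_
    filter_upwards [hM] with m hm
    have h1 := ((hW m).norm_pickIterate (w := Complex.I * r) hy hε1 hm.1 hm.2 (by simpa using hr1)
      (by simpa using (half_pos hr0).le) (by simpa using hr2)).1 m
    have hnorm : ‖(Complex.I * (r : ℂ))‖ = r := by simp [abs_of_pos hr0]
    have him : (Complex.I * (r : ℂ)).im = r := by simp
    rw [him] at h1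
    set F := pickIterate (W m) m (Complex.I * r)
    have h2 : 7 / 8 * r ≤ ‖F‖ := by
      have := norm_sub_norm_le (Complex.I * (r : ℂ)) F
      rw [hnorm, norm_sub_rev] at this
      nlinarith
    have hF0 : F ≠ 0 := norm_pos_iff.1 (lt_of_lt_of_le (by positivity) h2)
    have h3 := measureReal_tail_le (ρ m) hr0
    rw [hρG m _ (hI hr0)] at h3
    have h4 : 1 - Complex.I * r * F⁻¹ = (F - Complex.I * r) / F := by field_simp
    rw [h4, norm_div] at h3
    have h5 : ‖F - Complex.I * r‖ / ‖F‖ ≤ δ / 2 := by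
      rw [div_le_iff₀ (norm_pos_iff.2 hF0)]
      calc _ ≤ 4 * ε * r := h1
        _ ≤ δ / 2 * (7 / 8 * r) := by nlinarith
        _ ≤ _ := by gcongr
    refine le_trans ?_ hδη
    rw [← ENNReal.ofReal_toReal (measure_ne_top (ρ m) {x : ℝ | r < ‖x‖})]
    exact ENNReal.ofReal_le_ofReal (h3.trans (by linarith))
  let P : ℕ → ProbabilityMeasure ℝ := fun m => ⟨ρ m, hρ m⟩
  have hcpt : IsCompact (closure (range P)) := by
    refine isCompact_closure_of_isTightMeasureSet ?_
    convert htight using 1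
    ext μ
    constructor
    · rintro ⟨_, ⟨m, rfl⟩, rfl⟩
      exact ⟨m, rfl⟩
    · rintro ⟨m, rfl⟩
      exact ⟨P m, ⟨m, rfl⟩, rfl⟩
  -- A limit along an ultrafilter finer than `atTop` takes the place of a convergent subsequence.
  obtain ⟨Q, -, hQ⟩ := hcpt.ultrafilter_le_nhds ((hyperfilter ℕ).map P) (by
    rw [Ultrafilter.coe_map]
    exact (tendsto_principal.2 (Eventually.of_forall fun m => subset_closure (mem_range_self m))))
  have hU : (hyperfilter ℕ : Filter ℕ) ≤ atTop := by
    rw [← Nat.cofinite_eq_atTop]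
    exact hyperfilter_le_cofinite
  have hQt : Tendsto P (hyperfilter ℕ) (𝓝 Q) := hQ
  refine ⟨Q, Q.2, 1 / 2, by norm_num, ?_⟩
  obtain ⟨y, hy, M, hM⟩ := hctl (1 / 32) (by norm_num)
  refine ⟨max (2 * y) (32 * M), lt_max_of_lt_left (by positivity), fun w hw => ?_⟩
  have hw1 : 2 * y ≤ w.im := (le_max_left _ _).trans hw.1.le
  have hw2 : M ≤ 1 / 32 * w.im := by
    have := (le_max_right _ _).trans hw.1.le
    linarith
  have hw3 : |w.re| ≤ w.im / 2 := by have := hw.2; linarith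
  have hw0 : 0 < w.im := by linarith
  have hit := hM.mono fun m hm =>
    (hW m).norm_pickIterate hy le_rfl hm.1 hm.2 hw1 hw3 hw2
  set z := reciprocalCauchy Q w with hz
  have hFz : Tendsto (fun m => pickIterate (W m) m w) (hyperfilter ℕ) (𝓝 z) := by
    have h1 := (ProbabilityMeasure.tendsto_iff_forall_integral_rclike_tendsto ℂ).1 hQt
      (cauchyKernel w hw0)
    have h2 := h1.inv₀ (cauchyTransform_ne_zero (Q : Measure ℝ) hw0)
    refine h2.congr fun m => ?_
    have := hρG m w hw0
    exact inv_eq_iff_eq_inv.2 this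
  have hzw : ‖z - w‖ ≤ 4 * (1 / 32) * w.im :=
    le_of_tendsto (hFz.sub_const w).norm (hU (hit.mono fun m hm => hm.1 m))
  obtain ⟨hz1, hz2, -⟩ := cone_of_norm_sub_le hy le_rfl hw1 hw3 hzw
  -- Both the function and its argument move with `m`; the uniform Lipschitz bound on the cone
  -- reduces this to convergence at the fixed point `z`.
  have hWz : Tendsto (fun m => W m (pickIterate (W m) m w)) (hyperfilter ℕ) (𝓝 (V z)) := by
    have h1 : Tendsto (fun m => W m z) (hyperfilter ℕ) (𝓝 (V z)) :=
      (hlim z (by linarith)).mono_left hU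
    refine h1.congr_dist ?_
    have h2 : Tendsto (fun m => ‖z - pickIterate (W m) m w‖) (hyperfilter ℕ) (𝓝 0) := by
      simpa using (hFz.const_sub z).norm
    refine squeeze_zero' (Eventually.of_forall fun _ => dist_nonneg) ?_ h2
    filter_upwards [hU hit, hU hM] with m hm hm'
    obtain ⟨h3, h4, -⟩ := cone_of_norm_sub_le hy le_rfl hw1 hw3 (hm.1 m)
    rw [dist_eq_norm]
    refine ((hW m).norm_sub_le hy hz1 hz2 h3 h4).trans ?_
    exact mul_le_of_le_one_left (norm_nonneg _) (hm'.1.trans (by norm_num))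
  have hstep : Tendsto (fun m => pickIterate (W m) (m + 1) w - pickIterate (W m) m w)
      (hyperfilter ℕ) (𝓝 0) := by
    have h1 : Tendsto (fun m : ℕ => (1 / 2 : ℝ) ^ m * w.im) (hyperfilter ℕ) (𝓝 0) := by
      have := (tendsto_pow_atTop_nhds_zero_of_lt_one (r := (1 / 2 : ℝ)) (by norm_num)
        (by norm_num)).mul_const w.im
      rw [zero_mul] at this
      exact this.mono_left hU
    exact squeeze_zero_norm' (hU (hit.mono fun m hm => hm.2 m)) h1
  have hfin : Tendsto (fun m => pickIterate (W m) (m + 1) w - pickIterate (W m) m w)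
      (hyperfilter ℕ) (𝓝 (w - V z - z)) := by
    simp only [pickIterate]
    exact (hWz.const_sub w).sub hFz
  have := tendsto_nhds_unique hstep hfin
  linear_combination this

/-! ### Infinitely divisible exponents -/

/-- `ψ` is the exponent of an infinitely divisible law: `exp (ψ / n)` is a characteristic function
for every `n ≥ 1`. -/
structure IsInfDivExponent (ψ : ℝ → ℂ) : Prop where
  continuous : Continuous ψ
  zero : ψ 0 = 0
  root : ∀ n : ℕ, 1 ≤ n → ∃ μ : Measure ℝ, IsProbabilityMeasure μ ∧
    ∀ u, charFun μ u = Complex.exp (ψ u / n)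

theorem norm_exp_sub_one_le_of_re_nonpos {w : ℂ} (hw : w.re ≤ 0) :
    ‖Complex.exp w - 1‖ ≤ 2 * ‖w‖ := by
  rcases le_total ‖w‖ 1 with h | h
  · exact Complex.norm_exp_sub_one_le h
  · refine (norm_sub_le _ _).trans ?_
    rw [Complex.norm_exp, norm_one]
    have := Real.exp_le_one_iff.2 hw
    linarith

theorem tendsto_nat_mul_exp_div_sub_one (w : ℂ) :
    Tendsto (fun n : ℕ => (n : ℂ) * (Complex.exp (w / n) - 1)) atTop (𝓝 w) := by
  have h0 : Tendsto (fun n : ℕ => w / (n : ℂ)) atTop (𝓝 0) :=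
    tendsto_const_div_atTop_nhds_zero_nat w
  have h1 : Tendsto (fun n : ℕ => ‖w‖ ^ 2 / n) atTop (𝓝 0) :=
    tendsto_const_div_atTop_nhds_zero_nat _
  rw [tendsto_iff_norm_sub_tendsto_zero]
  refine squeeze_zero' (Eventually.of_forall fun _ => norm_nonneg _) ?_ h1
  have h2 := h0.norm
  rw [norm_zero] at h2
  filter_upwards [h2.eventually_lt_const one_pos, eventually_gt_atTop 0] with n hn hn0
  have hn' : (n : ℂ) ≠ 0 := Nat.cast_ne_zero.2 hn0.ne'
  have h3 : (n : ℂ) * (Complex.exp (w / n) - 1) - w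
      = n * (Complex.exp (w / n) - 1 - w / n) := by field_simp
  have hnpos : (0 : ℝ) < n := Nat.cast_pos.2 hn0
  rw [h3, norm_mul, Complex.norm_natCast]
  calc (n : ℝ) * ‖Complex.exp (w / n) - 1 - w / n‖ ≤ n * ‖w / n‖ ^ 2 := by
        gcongr
        exact Complex.norm_exp_sub_one_sub_id_le hn.le
    _ = ‖w‖ ^ 2 / n := by
        rw [norm_div, Complex.norm_natCast]
        field_simp

theorem integrable_exp_mul_I (μ : Measure ℝ) [IsFiniteMeasure μ] (u : ℝ) :
    Integrable (fun x : ℝ => Complex.exp (u * x * Complex.I)) μ := by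
  refine Integrable.of_bound (by fun_prop) 1 (Eventually.of_forall fun x => ?_)
  rw [← Complex.ofReal_mul, Complex.norm_exp_ofReal_mul_I]

/-- Integrate `e^{2iθ} - 1 - 2(e^{iθ} - 1) = (e^{iθ} - 1)²`, whose modulus is `-2 Re(e^{iθ} - 1)`.
-/
theorem norm_charFun_two_mul_sub_le (μ : Measure ℝ) [IsProbabilityMeasure μ] (u : ℝ) :
    ‖charFun μ (2 * u) - 1 - 2 * (charFun μ u - 1)‖ ≤ 2 * ‖charFun μ u - 1‖ := by
  have hi := integrable_exp_mul_I μ u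
  have hi2 := integrable_exp_mul_I μ (2 * u)
  have h1 : charFun μ u - 1 = ∫ x : ℝ, (Complex.exp (u * x * Complex.I) - 1) ∂μ := by
    rw [charFun_apply_real, integral_sub hi (integrable_const _)]
    simp
  have hi3 : Integrable (fun x : ℝ => Complex.exp (u * x * Complex.I) - 1) μ :=
    hi.sub (integrable_const _)
  have h2 : charFun μ (2 * u) - 1 - 2 * (charFun μ u - 1)
      = ∫ x : ℝ, (Complex.exp (u * x * Complex.I) - 1) ^ 2 ∂μ := by
    have h3 : ∀ x : ℝ, (Complex.exp (u * x * Complex.I) - 1) ^ 2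
        = Complex.exp ((2 * u : ℝ) * x * Complex.I) - 1
          - 2 * (Complex.exp (u * x * Complex.I) - 1) := by
      intro x
      have : Complex.exp ((2 * u : ℝ) * x * Complex.I)
          = Complex.exp (u * x * Complex.I) * Complex.exp (u * x * Complex.I) := by
        rw [← Complex.exp_add]
        congr 1
        push_cast
        ring
      rw [this]
      ring
    simp_rw [h3]
    have hi4 : Integrable (fun x : ℝ => Complex.exp ((2 * u : ℝ) * x * Complex.I) - 1) μ :=
      hi2.sub (integrable_const _)
    rw [integral_sub hi4 (hi3.const_mul 2),
      integral_sub hi2 (integrable_const _), integral_const_mul, ← h1, charFun_apply_real]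
    simp
  have h4 : ∀ x : ℝ, ‖(Complex.exp (u * x * Complex.I) - 1) ^ 2‖
      = -2 * (Complex.exp (u * x * Complex.I) - 1).re := by
    intro x
    rw [norm_pow, Complex.sq_norm, Complex.normSq_apply, ← Complex.ofReal_mul]
    simp only [Complex.sub_re, Complex.sub_im, Complex.exp_ofReal_mul_I_re,
      Complex.exp_ofReal_mul_I_im, Complex.one_re, Complex.one_im]
    nlinarith [Real.sin_sq_add_cos_sq (u * x)]
  rw [h2]
  refine (norm_integral_le_integral_norm _).trans ?_
  simp_rw [h4]
  rw [integral_const_mul]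
  have h5 : ∫ x : ℝ, (Complex.exp (u * x * Complex.I) - 1).re ∂μ = (charFun μ u - 1).re := by
    rw [h1]
    exact integral_re hi3
  rw [h5]
  have := (neg_le_abs _).trans (Complex.abs_re_le_norm (charFun μ u - 1))
  linarith

namespace IsInfDivExponent

variable {ψ : ℝ → ℂ}

theorem re_nonpos (h : IsInfDivExponent ψ) (u : ℝ) : (ψ u).re ≤ 0 := by
  obtain ⟨μ, hμ, h1⟩ := h.root 1 le_rfl
  have := norm_charFun_le_one (μ := μ) u
  rw [h1, Complex.norm_exp, Real.exp_le_one_iff] at this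
  simpa using this

/-- The preceding inequality for the `n`-th root, multiplied by `n`, passes to the limit because
`n(e^{ψ/n} - 1) → ψ`. No Lévy–Khintchine representation is involved. -/
theorem norm_two_mul_le (h : IsInfDivExponent ψ) (u : ℝ) : ‖ψ (2 * u)‖ ≤ 4 * ‖ψ u‖ := by
  have h1 := tendsto_nat_mul_exp_div_sub_one (ψ u)
  have h2 := tendsto_nat_mul_exp_div_sub_one (ψ (2 * u))
  have h3 : ‖ψ (2 * u) - 2 * ψ u‖ ≤ 2 * ‖ψ u‖ := by
    refine le_of_tendsto_of_tendsto (h2.sub (h1.const_mul 2)).norm (h1.norm.const_mul 2) ?_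
    filter_upwards [eventually_ge_atTop 1] with n hn
    obtain ⟨μ, hμ, hc⟩ := h.root n hn
    rw [← hc, ← hc]
    have h4 : (n : ℂ) * (charFun μ (2 * u) - 1) - 2 * (n * (charFun μ u - 1))
        = n * (charFun μ (2 * u) - 1 - 2 * (charFun μ u - 1)) := by ring
    rw [h4, norm_mul, norm_mul]
    have := norm_charFun_two_mul_sub_le μ u
    have h5 := norm_nonneg (n : ℂ)
    nlinarith
  have h6 : ‖ψ (2 * u)‖ ≤ ‖ψ (2 * u) - 2 * ψ u‖ + ‖2 * ψ u‖ := by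
    simpa using norm_add_le (ψ (2 * u) - 2 * ψ u) (2 * ψ u)
  rw [norm_mul, Complex.norm_ofNat] at h6
  linarith

/-- Doubling the argument costs a factor `4 = 2²`, so dyadic iteration from `[-1, 1]` gives
quadratic growth; this is what makes all the Laplace integrals converge. -/
theorem exists_norm_le (h : IsInfDivExponent ψ) : ∃ C, 0 ≤ C ∧ ∀ u, ‖ψ u‖ ≤ C * (1 + u ^ 2) := by
  obtain ⟨C, hC⟩ := isCompact_Icc.exists_bound_of_continuousOn (s := Icc (-1 : ℝ) 1)
    h.continuous.continuousOn
  have hC0 : 0 ≤ C := (norm_nonneg _).trans (hC 0 (by simp))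
  have hpow : ∀ n : ℕ, ∀ u, |u| ≤ 2 ^ n → ‖ψ u‖ ≤ C * 4 ^ n := by
    intro n
    induction n with
    | zero =>
      intro u hu
      simpa using hC u (abs_le.1 (by simpa using hu))
    | succ n ih =>
      intro u hu
      have h1 := h.norm_two_mul_le (u / 2)
      rw [mul_div_cancel₀ _ (two_ne_zero)] at h1
      have h2 := ih (u / 2) (by
        rw [abs_div, abs_two, div_le_iff₀ two_pos, ← pow_succ]
        exact hu)
      rw [pow_succ]
      linarith
  refine ⟨4 * C, by positivity, fun u => ?_⟩
  rcases le_total |u| 1 with hu | hu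
  · have := hpow 0 u (by simpa using hu)
    rw [pow_zero, mul_one] at this
    nlinarith [sq_nonneg u]
  · obtain ⟨n, hn, hn'⟩ := exists_nat_pow_near hu (one_lt_two (α := ℝ))
    have h1 := hpow (n + 1) u hn'.le
    have h2 : (4 : ℝ) ^ n ≤ u ^ 2 := by
      rw [← sq_abs]
      calc (4 : ℝ) ^ n = (2 ^ n) ^ 2 := by rw [← pow_mul, mul_comm, pow_mul]; norm_num
        _ ≤ _ := by gcongr
    rw [pow_succ] at h1
    nlinarith

theorem div_nat (h : IsInfDivExponent ψ) {m : ℕ} (hm : 1 ≤ m) :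
    IsInfDivExponent fun u => ψ u / m where
  continuous := h.continuous.div_const _
  zero := by simp [h.zero]
  root n hn := by
    obtain ⟨μ, hμ, h1⟩ := h.root (m * n) (Nat.mul_pos hm hn)
    refine ⟨μ, hμ, fun u => ?_⟩
    rw [h1, div_div]
    push_cast
    rfl

end IsInfDivExponent

/-! ### Laplace transforms of functions of quadratic growth -/

theorem integrableOn_pow_mul_exp_neg (n : ℕ) {y : ℝ} (hy : 0 < y) :
    IntegrableOn (fun u : ℝ => u ^ n * Real.exp (-(y * u))) (Ioi 0) := by
  have := integrableOn_rpow_mul_exp_neg_mul_rpow (p := 1) (s := n) (b := y)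
    (by have := n.cast_nonneg (α := ℝ); linarith) one_pos hy
  simpa using this

theorem integrableOn_growth_mul_exp_neg {y : ℝ} (hy : 0 < y) :
    IntegrableOn (fun u : ℝ => (1 + u ^ 2) * Real.exp (-(y * u))) (Ioi 0) := by
  refine ((integrableOn_pow_mul_exp_neg 0 hy).add (integrableOn_pow_mul_exp_neg 2 hy)).congr_fun
    (fun u _ => ?_) measurableSet_Ioi
  simp only [Pi.add_apply]
  ring

theorem integrableOn_mul_growth_mul_exp_neg {y : ℝ} (hy : 0 < y) :
    IntegrableOn (fun u : ℝ => u * (1 + u ^ 2) * Real.exp (-(y * u))) (Ioi 0) := by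
  refine ((integrableOn_pow_mul_exp_neg 1 hy).add (integrableOn_pow_mul_exp_neg 3 hy)).congr_fun
    (fun u _ => ?_) measurableSet_Ioi
  simp only [Pi.add_apply]
  ring

theorem norm_exp_I_mul (z : ℂ) (u : ℝ) :
    ‖Complex.exp (Complex.I * z * u)‖ = Real.exp (-(z.im * u)) := by
  rw [Complex.norm_exp]
  simp

theorem integrableOn_mul_exp {g : ℝ → ℂ} (hg : Continuous g) {C : ℝ}
    (hC : ∀ u, ‖g u‖ ≤ C * (1 + u ^ 2)) {z : ℂ} (hz : 0 < z.im) :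
    IntegrableOn (fun u : ℝ => g u * Complex.exp (Complex.I * z * u)) (Ioi 0) := by
  refine ((integrableOn_growth_mul_exp_neg hz).const_mul C).mono' (by fun_prop)
    (Eventually.of_forall fun u => ?_)
  rw [norm_mul, norm_exp_I_mul, ← mul_assoc]
  gcongr
  exact hC u

/-- Laplace transforms are holomorphic. -/
theorem hasDerivAt_laplace {g : ℝ → ℂ} (hg : Continuous g) {C : ℝ}
    (hC : ∀ u, ‖g u‖ ≤ C * (1 + u ^ 2)) {z : ℂ} (hz : 0 < z.im) :
    IntegrableOn (fun u : ℝ => g u * (Complex.exp (Complex.I * z * u) * (Complex.I * u))) (Ioi 0) ∧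
    HasDerivAt (fun z : ℂ => ∫ u in Ioi (0 : ℝ), g u * Complex.exp (Complex.I * z * u))
      (∫ u in Ioi (0 : ℝ), g u * (Complex.exp (Complex.I * z * u) * (Complex.I * u))) z := by
  have hopen : {w : ℂ | z.im / 2 < w.im} ∈ 𝓝 z :=
    (isOpen_lt continuous_const Complex.continuous_im).mem_nhds (by simpa using hz)
  refine hasDerivAt_integral_of_dominated_loc_of_deriv_le
    (F := fun z u => g u * Complex.exp (Complex.I * z * u))
    (F' := fun z u => g u * (Complex.exp (Complex.I * z * u) * (Complex.I * u)))
    (bound := fun u => C * (u * (1 + u ^ 2) * Real.exp (-(z.im / 2 * u)))) hopen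
    (Eventually.of_forall fun w => by fun_prop) (integrableOn_mul_exp hg hC hz) (by fun_prop) ?_
    ((integrableOn_mul_growth_mul_exp_neg (half_pos hz)).const_mul C) ?_
  · filter_upwards [ae_restrict_mem measurableSet_Ioi] with u hu w hw
    have hu0 : 0 < u := hu
    have hw0 : z.im / 2 < w.im := hw
    rw [norm_mul, norm_mul, norm_exp_I_mul, norm_mul, Complex.norm_I, one_mul, Complex.norm_real,
      Real.norm_of_nonneg hu0.le]
    calc ‖g u‖ * (Real.exp (-(w.im * u)) * u)
        ≤ C * (1 + u ^ 2) * (Real.exp (-(z.im / 2 * u)) * u) := by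
          gcongr
          · exact (norm_nonneg _).trans (hC u)
          · exact hC u
      _ = _ := by ring
  · refine Eventually.of_forall fun u w _ => ?_
    have h1 : HasDerivAt (fun z : ℂ => Complex.I * z * u) (Complex.I * u) w := by
      simpa using ((hasDerivAt_id w).const_mul Complex.I).mul_const (u : ℂ)
    exact h1.cexp.const_mul (g u)

/-! ### The Bercovici–Pata map -/

/-- The Voiculescu transform `V(z) = -i z² ∫_0^∞ ψ(-u) e^{izu} du` attached to an exponent. -/
noncomputable def voiculescuOfExponent (ψ : ℝ → ℂ) (z : ℂ) : ℂ :=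
  -Complex.I * z ^ 2 * ∫ u in Ioi (0 : ℝ), ψ (-u) * Complex.exp (Complex.I * z * u)

theorem voiculescuOfExponent_I_mul (ψ : ℝ → ℂ) (t : ℝ) :
    voiculescuOfExponent ψ (Complex.I * t) = Complex.I * (t : ℂ) ^ 2 *
      ∫ u in Ioi (0 : ℝ), ψ (-u) * Complex.exp (-(t * u : ℂ)) := by
  rw [voiculescuOfExponent]
  have h : ∀ u : ℝ, Complex.I * (Complex.I * t) * u = -(t * u : ℂ) := fun u => by
    linear_combination (t * u : ℂ) * Complex.I_mul_I
  simp_rw [h]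
  rw [mul_pow, Complex.I_sq]
  ring

theorem voiculescuOfExponent_div (ψ : ℝ → ℂ) (c z : ℂ) :
    voiculescuOfExponent (fun u => ψ u / c) z = voiculescuOfExponent ψ z / c := by
  simp only [voiculescuOfExponent, div_mul_eq_mul_div]
  rw [integral_div]
  ring

/-- The characteristic function of a law is approximated by those of finitely supported laws. -/
theorem exists_norm_charFun_sub_sum_le (μ : Measure ℝ) [IsProbabilityMeasure μ] {ε : ℝ}
    (hε : 0 < ε) : ∃ (s : Finset ℝ) (p : ℝ → ℝ), (∀ x, 0 ≤ p x) ∧ ∀ u : ℝ,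
      ‖charFun μ u - 1 - ∑ x ∈ s, (p x : ℂ) * (Complex.exp (u * x * Complex.I) - 1)‖
        ≤ (2 + |u|) * ε := by
  let f : ℕ → SimpleFunc ℝ ℝ :=
    fun k => SimpleFunc.approxOn id measurable_id univ 0 (mem_univ 0) k
  have hf : ∀ x, Tendsto (fun k => f k x) atTop (𝓝 x) := fun x =>
    SimpleFunc.tendsto_approxOn measurable_id (mem_univ 0) (by simp)
  have hmeas : ∀ k, Measurable fun x => min 1 |x - f k x| := fun k =>
    measurable_const.min (measurable_id.sub (f k).measurable).abs
  have hbd : ∀ k x, ‖min 1 |x - f k x|‖ ≤ 1 := fun k x => by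
    rw [Real.norm_of_nonneg (by positivity)]
    exact min_le_left _ _
  have hlim : Tendsto (fun k => ∫ x, min 1 |x - f k x| ∂μ) atTop (𝓝 0) := by
    have := tendsto_integral_of_dominated_convergence (μ := μ)
      (F := fun k x => min 1 |x - f k x|) (f := fun _ => (0 : ℝ)) (fun _ => (1 : ℝ))
      (fun k => (hmeas k).aestronglyMeasurable) (integrable_const _)
      (fun k => Eventually.of_forall (hbd k)) (Eventually.of_forall fun x => by
        have := (tendsto_const_nhds (x := (1 : ℝ))).min ((hf x).const_sub x).abs
        simpa using this)
    simpa using this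
  obtain ⟨k, hk⟩ := (hlim.eventually_lt_const hε).exists
  refine ⟨(f k).range, fun x => μ.real (f k ⁻¹' {x}), fun x => measureReal_nonneg, fun u => ?_⟩
  have hif : Integrable (f k) μ := SimpleFunc.integrable_of_isFiniteMeasure _
  have h1 : ∑ x ∈ (f k).range, (μ.real (f k ⁻¹' {x}) : ℂ) * (Complex.exp (u * x * Complex.I) - 1)
      = ∫ x, (Complex.exp (u * f k x * Complex.I) - 1) ∂μ := by
    have := SimpleFunc.map_integral (f k) (fun x : ℝ => Complex.exp (u * x * Complex.I) - 1) hif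
      (by simp)
    rw [SimpleFunc.integral_eq_integral _ (SimpleFunc.integrable_of_isFiniteMeasure _)] at this
    simpa [Complex.real_smul] using this.symm
  have hi := integrable_exp_mul_I μ u
  have hi2 : Integrable (fun x : ℝ => Complex.exp (u * f k x * Complex.I)) μ := by
    refine Integrable.of_bound ?_ 1 (Eventually.of_forall fun x => ?_)
    · have := (f k).measurable
      exact Measurable.aestronglyMeasurable (by fun_prop)
    · rw [← Complex.ofReal_mul, Complex.norm_exp_ofReal_mul_I]
  rw [h1, charFun_apply_real, integral_sub hi2 (integrable_const _)]
  simp only [integral_const, probReal_univ, one_smul]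
  rw [sub_sub_sub_cancel_right, ← integral_sub hi hi2]
  -- The trivial bound 2 serves for large differences and the Lipschitz bound `|u|` for small ones;
  -- truncating at 1 avoids any moment assumption on `μ`.
  have h2 : ∀ x : ℝ, ‖Complex.exp (u * x * Complex.I) - Complex.exp (u * f k x * Complex.I)‖
      ≤ (2 + |u|) * min 1 |x - f k x| := by
    intro x
    have h3 : Complex.exp (u * x * Complex.I) - Complex.exp (u * f k x * Complex.I)
        = Complex.exp ((u * f k x : ℝ) * Complex.I)
          * (Complex.exp (Complex.I * (u * (x - f k x) : ℝ)) - 1) := by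
      rw [mul_sub, mul_one, ← Complex.exp_add]
      congr 2 <;> push_cast <;> ring
    rw [h3, norm_mul, Complex.norm_exp_ofReal_mul_I, one_mul]
    rcases le_total 1 |x - f k x| with h4 | h4
    · rw [min_eq_left h4, mul_one]
      refine (norm_sub_le _ _).trans ?_
      rw [mul_comm, Complex.norm_exp_ofReal_mul_I, norm_one]
      have := abs_nonneg u
      linarith
    · rw [min_eq_right h4]
      refine Real.norm_exp_I_mul_ofReal_sub_one_le.trans ?_
      rw [norm_mul, Real.norm_eq_abs, Real.norm_eq_abs]
      gcongr
      linarith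
  refine (norm_integral_le_of_norm_le (g := fun x => (2 + |u|) * min 1 |x - f k x|) ?_
    (Eventually.of_forall h2)).trans ?_
  · exact (Integrable.of_bound (hmeas k).aestronglyMeasurable 1
      (Eventually.of_forall (hbd k))).const_mul _
  · rw [integral_const_mul]
    gcongr

/-- The jump exponent `e^{iux} - 1` is sent to `z²(1/(z - x) - 1/z) = x + x²/(z - x)`, a rational
Pick function. -/
theorem voiculescuOfExponent_sum (s : Finset ℝ) (p : ℝ → ℝ) {z : ℂ} (hz : 0 < z.im) :
    voiculescuOfExponent (fun u => ∑ x ∈ s, (p x : ℂ) * (Complex.exp (u * x * Complex.I) - 1)) z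
      = ∑ x ∈ s, (p x : ℂ) * (x + x ^ 2 / (z - x)) := by
  have hre : ∀ x : ℝ, (Complex.I * (z - x)).re < 0 := fun x => by simpa using hz
  have h1 : ∀ u : ℝ, (∑ x ∈ s, (p x : ℂ) * (Complex.exp ((-u : ℝ) * x * Complex.I) - 1))
      * Complex.exp (Complex.I * z * u)
      = ∑ x ∈ s, (p x : ℂ) * (Complex.exp (Complex.I * (z - x) * u)
        - Complex.exp (Complex.I * (z - (0 : ℝ)) * u)) := by
    intro u
    rw [Finset.sum_mul]
    refine Finset.sum_congr rfl fun x _ => ?_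
    rw [mul_assoc, sub_mul, one_mul, ← Complex.exp_add]
    congr 3 <;> congr 1 <;> push_cast <;> ring
  rw [voiculescuOfExponent]
  simp only [h1]
  rw [integral_finsetSum]
  · rw [Finset.mul_sum]
    refine Finset.sum_congr rfl fun x _ => ?_
    rw [integral_const_mul, integral_sub (integrableOn_exp_mul_complex_Ioi (hre x) 0)
      (integrableOn_exp_mul_complex_Ioi (hre 0) 0), integral_exp_mul_complex_Ioi (hre x),
      integral_exp_mul_complex_Ioi (hre 0)]
    have h2 := sub_ofReal_ne_zero hz x
    have h3 := sub_ofReal_ne_zero hz 0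
    simp only [Complex.ofReal_zero, mul_zero, Complex.exp_zero, sub_zero] at h3 ⊢
    field_simp
    ring
  · intro x _
    exact ((integrableOn_exp_mul_complex_Ioi (hre x) 0).sub
      (integrableOn_exp_mul_complex_Ioi (hre 0) 0)).const_mul _

theorem isFinitePick_sum (s : Finset ℝ) (p : ℝ → ℝ) (hp : ∀ x, 0 ≤ p x) :
    IsFinitePick fun z => ∑ x ∈ s, (p x : ℂ) * (x + x ^ 2 / (z - x)) := by
  refine ⟨s, inferInstance, ∑ x ∈ s, p x * x, fun x => p x * (x : ℝ) ^ 2, fun x => x,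
    fun x => mul_nonneg (hp _) (sq_nonneg _), fun z _ => ?_⟩
  rw [Finset.sum_coe_sort s fun x => ((p x * x ^ 2 : ℝ) : ℂ) / (z - x)]
  push_cast
  rw [← Finset.sum_add_distrib]
  exact Finset.sum_congr rfl fun x _ => by ring

namespace IsInfDivExponent

variable {ψ : ℝ → ℂ}

theorem continuous_comp_neg (h : IsInfDivExponent ψ) : Continuous fun u => ψ (-u) :=
  h.continuous.comp continuous_neg

theorem differentiableOn_voiculescu (h : IsInfDivExponent ψ) :
    DifferentiableOn ℂ (voiculescuOfExponent ψ) {z | 0 < z.im} := by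
  obtain ⟨C, -, hC⟩ := h.exists_norm_le
  intro z hz
  have := (hasDerivAt_laplace h.continuous_comp_neg (fun u => by simpa using hC (-u)) hz).2
  exact ((by fun_prop : DifferentiableAt ℂ (fun z : ℂ => -Complex.I * z ^ 2) z).mul
    this.differentiableAt).differentiableWithinAt

/-- With `s = yu` the quotient becomes `i ∫_0^∞ ψ(-s/y) e^{-s} ds`, which tends to `0` because `ψ`
is continuous with `ψ 0 = 0`. -/
theorem tendsto_voiculescu_div (h : IsInfDivExponent ψ) :
    Tendsto (fun y : ℝ => voiculescuOfExponent ψ (Complex.I * y) / y) atTop (𝓝 0) := by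
  obtain ⟨C, hC0, hC⟩ := h.exists_norm_le
  have h1 : Tendsto (fun y : ℝ => ∫ s in Ioi (0 : ℝ), ψ (-(s / y)) * Complex.exp (-(s : ℂ))) atTop
      (𝓝 (∫ s in Ioi (0 : ℝ), (0 : ℂ))) := by
    refine tendsto_integral_filter_of_dominated_convergence
      (fun s => C * ((1 + s ^ 2) * Real.exp (-(1 * s)))) (Eventually.of_forall fun y => ?_) ?_
      ((integrableOn_growth_mul_exp_neg one_pos).const_mul C) ?_
    · have := h.continuous
      exact Continuous.aestronglyMeasurable (by fun_prop)
    · filter_upwards [eventually_ge_atTop 1] with y hy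
      refine Eventually.of_forall fun s => ?_
      rw [norm_mul, Complex.norm_exp, Complex.neg_re, Complex.ofReal_re, one_mul, ← mul_assoc]
      gcongr
      refine (hC _).trans ?_
      gcongr C * (1 + ?_)
      rw [neg_sq, div_pow]
      exact div_le_self (sq_nonneg s) (one_le_pow₀ hy)
    · refine Eventually.of_forall fun s => ?_
      have h2 : Tendsto (fun y : ℝ => -(s / y)) atTop (𝓝 0) := by
        simpa using (tendsto_const_nhds.div_atTop tendsto_id : Tendsto (fun y : ℝ => s / y) _ _).neg
      have h3 := ((h.continuous.tendsto 0).comp h2).mul_const (Complex.exp (-(s : ℂ)))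
      simpa [h.zero] using h3
  rw [integral_zero] at h1
  have h4 := h1.const_mul Complex.I
  rw [mul_zero] at h4
  refine h4.congr' ?_
  filter_upwards [eventually_gt_atTop 0] with y hy
  rw [voiculescuOfExponent_I_mul]
  have h5 := integral_comp_mul_left_Ioi
    (fun s : ℝ => ψ (-(s / y)) * Complex.exp (-(s : ℂ))) 0 hy
  rw [mul_zero] at h5
  have hy' : (y : ℂ) ≠ 0 := Complex.ofReal_ne_zero.2 hy.ne'
  have h6 : ∀ u : ℝ, ψ (-u) * Complex.exp (-(y * u : ℂ))
      = ψ (-(y * u / y)) * Complex.exp (-((y * u : ℝ) : ℂ)) := by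
    intro u
    rw [mul_div_cancel_left₀ _ hy.ne']
    push_cast
    rfl
  simp_rw [h6]
  rw [h5, Complex.real_smul]
  push_cast
  field_simp

/-- Compound Poisson approximation: `n(e^{ψ/n} - 1) → ψ`, with the `n`-th root law replaced by a
finitely supported one. Quadratic growth dominates the integrands. -/
theorem exists_tendsto_finitePick (h : IsInfDivExponent ψ) :
    ∃ W : ℕ → ℂ → ℂ, (∀ m, IsFinitePick (W m)) ∧ ∀ z : ℂ, 0 < z.im →
      Tendsto (fun m => W m z) atTop (𝓝 (voiculescuOfExponent ψ z)) := by
  obtain ⟨C, hC0, hC⟩ := h.exists_norm_le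
  have hex : ∀ m : ℕ, ∃ (s : Finset ℝ) (p : ℝ → ℝ), (∀ x, 0 ≤ p x) ∧ ∀ u : ℝ,
      ‖((m + 1 : ℕ) : ℂ) * (Complex.exp (ψ u / (m + 1 : ℕ)) - 1)
        - ∑ x ∈ s, (p x : ℂ) * (Complex.exp (u * x * Complex.I) - 1)‖
          ≤ (2 + |u|) * ((m + 1 : ℕ) : ℝ)⁻¹ := by
    intro m
    obtain ⟨μ, hμ, hμc⟩ := h.root (m + 1) (by omega)
    have hm : (0 : ℝ) < ((m + 1 : ℕ) : ℝ) := by positivity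
    -- Accuracy `n⁻²` with `n = m + 1`, since the error is multiplied by `n` afterwards.
    obtain ⟨s, p, hp, hs⟩ := exists_norm_charFun_sub_sum_le μ
      (ε := ((m + 1 : ℕ) : ℝ)⁻¹ * ((m + 1 : ℕ) : ℝ)⁻¹) (by positivity)
    refine ⟨s, fun x => (m + 1 : ℕ) * p x, fun x => mul_nonneg hm.le (hp x), fun u => ?_⟩
    have h1 := mul_le_mul_of_nonneg_left (hs u) hm.le
    rw [← Complex.norm_natCast, ← norm_mul, mul_sub, Finset.mul_sum, hμc] at h1
    rw [Complex.norm_natCast] at h1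
    have h2 : ((m + 1 : ℕ) : ℝ) * ((2 + |u|) * (((m + 1 : ℕ) : ℝ)⁻¹ * ((m + 1 : ℕ) : ℝ)⁻¹))
        = (2 + |u|) * ((m + 1 : ℕ) : ℝ)⁻¹ := by field_simp
    rw [h2] at h1
    have h3 : ∑ x ∈ s, (((m + 1 : ℕ) * p x : ℝ) : ℂ) * (Complex.exp (u * x * Complex.I) - 1)
        = ∑ x ∈ s, ((m + 1 : ℕ) : ℂ) * ((p x : ℂ) * (Complex.exp (u * x * Complex.I) - 1)) :=
      Finset.sum_congr rfl fun x _ => by push_cast; ring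
    rw [h3]
    exact h1
  choose s p hp hs using hex
  refine ⟨fun m z => ∑ x ∈ s m, (p m x : ℂ) * (x + x ^ 2 / (z - x)),
    fun m => isFinitePick_sum _ _ (hp m), fun z hz => ?_⟩
  simp_rw [← voiculescuOfExponent_sum _ _ hz]
  refine Tendsto.const_mul _ ?_
  refine tendsto_integral_of_dominated_convergence
    (fun u => (2 * C + 3) * ((1 + u ^ 2) * Real.exp (-(z.im * u)))) (fun m => ?_)
    ((integrableOn_growth_mul_exp_neg hz).const_mul _) (fun m => ?_) ?_
  · exact Continuous.aestronglyMeasurable (by fun_prop)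
  · refine Eventually.of_forall fun u => ?_
    rw [norm_mul, norm_exp_I_mul, ← mul_assoc]
    gcongr
    have h1 := hs m (-u)
    have hm : (0 : ℝ) < ((m + 1 : ℕ) : ℝ) := by positivity
    have h2 : ‖((m + 1 : ℕ) : ℂ) * (Complex.exp (ψ (-u) / (m + 1 : ℕ)) - 1)‖
        ≤ 2 * ‖ψ (-u)‖ := by
      rw [norm_mul, Complex.norm_natCast]
      have h3 := norm_exp_sub_one_le_of_re_nonpos (w := ψ (-u) / (m + 1 : ℕ)) (by
        rw [Complex.div_natCast_re]
        exact div_nonpos_of_nonpos_of_nonneg (h.re_nonpos _) hm.le)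
      rw [norm_div, Complex.norm_natCast] at h3
      calc _ ≤ ((m + 1 : ℕ) : ℝ) * (2 * (‖ψ (-u)‖ / ((m + 1 : ℕ) : ℝ))) := by gcongr
        _ = _ := by field_simp
    have h4 : (2 + |(-u)|) * ((m + 1 : ℕ) : ℝ)⁻¹ ≤ 2 + |u| := by
      rw [abs_neg]
      refine mul_le_of_le_one_right (by positivity) (inv_le_one_of_one_le₀ ?_)
      exact_mod_cast Nat.le_add_left 1 m
    have h5 := hC (-u)
    rw [neg_sq] at h5
    have h6 := norm_sub_norm_le
      (∑ x ∈ s m, (p m x : ℂ) * (Complex.exp ((-u : ℝ) * x * Complex.I) - 1))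
      (((m + 1 : ℕ) : ℂ) * (Complex.exp (ψ (-u) / (m + 1 : ℕ)) - 1))
    rw [norm_sub_rev] at h6
    have h7 : |u| ≤ 1 + u ^ 2 := by
      rw [← sq_abs u]
      nlinarith [sq_nonneg (|u| - 1)]
    nlinarith [sq_nonneg u]
  · refine Eventually.of_forall fun u => Tendsto.mul_const _ ?_
    have h1 := (tendsto_nat_mul_exp_div_sub_one (ψ (-u))).comp (tendsto_add_atTop_nat 1)
    refine h1.congr_dist ?_
    have h2 : Tendsto (fun m : ℕ => (2 + |(-u)|) * ((m + 1 : ℕ) : ℝ)⁻¹) atTop (𝓝 0) := by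
      have := (tendsto_inv_atTop_nhds_zero_nat (𝕜 := ℝ)).comp (tendsto_add_atTop_nat 1)
      simpa using this.const_mul (2 + |(-u)|)
    refine squeeze_zero (fun _ => dist_nonneg) (fun m => ?_) h2
    rw [dist_eq_norm]
    exact hs m (-u)

theorem exists_isVoiculescuTransform (h : IsInfDivExponent ψ) :
    ∃ ρ : Measure ℝ, IsProbabilityMeasure ρ ∧
      IsVoiculescuTransform ρ (voiculescuOfExponent ψ) := by
  obtain ⟨W, hW, hlim⟩ := h.exists_tendsto_finitePick
  exact exists_isVoiculescuTransform_of_tendsto hW hlim h.tendsto_voiculescu_div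

/-- The free counterpart of an infinitely divisible law. -/
theorem exists_isFreelyInfDiv (h : IsInfDivExponent ψ) :
    ∃ ρ : Measure ℝ, IsFreelyInfDiv ρ ∧ IsImaginaryAxisTransform ρ (fun t =>
      Complex.I * (t : ℂ) ^ 2 * ∫ u in Ioi (0 : ℝ), ψ (-u) * Complex.exp (-(t * u : ℂ))) := by
  obtain ⟨ρ, hρ, hV⟩ := h.exists_isVoiculescuTransform
  refine ⟨ρ, ⟨hρ, fun n hn => ?_⟩, voiculescuOfExponent ψ, h.differentiableOn_voiculescu, hV,
    fun t _ => (voiculescuOfExponent_I_mul ψ t).symm⟩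
  -- The free `n`-th root belongs to `ψ / n`, whose transform is `V / n`.
  obtain ⟨μ, hμ, hVμ⟩ := (h.div_nat hn).exists_isVoiculescuTransform
  refine ⟨μ, hμ, fun _ => voiculescuOfExponent fun u => ψ u / n, fun _ => hVμ, ?_⟩
  have hn0 : (n : ℂ) ≠ 0 := Nat.cast_ne_zero.2 (by omega)
  convert hV using 2 with z
  simp only [voiculescuOfExponent_div]
  rw [Finset.sum_const, Finset.card_univ, Fintype.card_fin, nsmul_eq_mul]
  field_simp

end IsInfDivExponent

/-! ### The exponent of a Lévy process -/

theorem intervalIntegral_exp_mul (w : ℂ) (b : ℝ) :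
    (∫ x in (0 : ℝ)..b, Complex.exp (x * w)) * w = Complex.exp (b * w) - 1 := by
  simp_rw [mul_comm _ w]
  rcases eq_or_ne w 0 with rfl | hw
  · simp
  · rw [integral_exp_mul_complex hw]
    field_simp
    simp

/-- Continuous multiplicative functions on the half-line are exponentials. -/
theorem exists_eq_exp_of_map_add {h : ℝ≥0 → ℂ} (hc : Continuous h) (h0 : h 0 = 1)
    (hadd : ∀ s t, h (s + t) = h s * h t) : ∃ w : ℂ, ∀ t : ℝ≥0, h t = Complex.exp (t * w) := by
  let g : ℝ → ℂ := fun x => h x.toNNReal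
  have hg : Continuous g := hc.comp continuous_real_toNNReal
  have hg0 : g 0 = 1 := by simp [g, h0]
  have hgadd : ∀ x y : ℝ, 0 ≤ x → 0 ≤ y → g (x + y) = g x * g y := fun x y hx hy => by
    simp only [g, Real.toNNReal_add hx hy, hadd]
  let H : ℝ → ℂ := fun x => ∫ s in (0 : ℝ)..x, g s
  have hH : ∀ x, HasDerivAt H (g x) x := fun x => (hg.integral_hasStrictDerivAt 0 x).hasDerivAt
  obtain ⟨δ, hδ, hδ0⟩ : ∃ δ : ℝ, H δ ≠ 0 ∧ 0 < δ := by
    have h1 := (hH 0).eventually_ne (c := 0) (by simp [hg0])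
    exact ((h1.filter_mono (nhdsWithin_mono _ fun x (hx : x ∈ Ioi (0 : ℝ)) => ne_of_gt hx)).and
      (self_mem_nhdsWithin (s := Ioi (0 : ℝ)))).exists
  let w : ℂ := (g δ - 1) / H δ
  -- A differentiable copy of `g`: multiplicativity gives `∫_x^{x+δ} g = g(x) H(δ)`, so `k = g` on
  -- the half-line, and there `k' = w k`.
  let k : ℝ → ℂ := fun x => (H (x + δ) - H x) / H δ
  have hk : ∀ x, 0 ≤ x → k x = g x := by
    intro x hx
    have h1 : H (x + δ) - H x = ∫ s in (0 : ℝ)..δ, g (x + s) := by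
      rw [intervalIntegral.integral_comp_add_left, add_zero]
      exact intervalIntegral.integral_interval_sub_left (hg.intervalIntegrable _ _)
        (hg.intervalIntegrable _ _)
    have h2 : ∫ s in (0 : ℝ)..δ, g (x + s) = g x * H δ := by
      rw [← intervalIntegral.integral_const_mul]
      refine intervalIntegral.integral_congr fun s hs => ?_
      rw [uIcc_of_le hδ0.le] at hs
      exact hgadd x s hx hs.1
    simp only [k]
    rw [h1, h2, mul_div_cancel_right₀ _ hδ]
  have hk' : ∀ x, HasDerivAt k ((g (x + δ) - g x) / H δ) x := fun x =>
    (((hH (x + δ)).comp_add_const x δ).sub (hH x)).div_const _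
  have hf : ∀ x, HasDerivAt (fun x : ℝ => k x * Complex.exp (-(x * w)))
      ((g (x + δ) - g x) / H δ * Complex.exp (-(x * w))
        + k x * (Complex.exp (-(x * w)) * -w)) x := by
    intro x
    refine (hk' x).mul ?_
    have : HasDerivAt (fun x : ℝ => -((x : ℂ) * w)) (-w) x := by
      have h1 := ((Complex.ofRealCLM.hasDerivAt (x := x)).mul_const w).fun_neg
      simpa using h1
    exact this.cexp
  refine ⟨w, fun t => ?_⟩
  have hconst := constant_of_has_deriv_right_zero (a := 0) (b := (t : ℝ))
    (f := fun x : ℝ => k x * Complex.exp (-(x * w)))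
    (fun x _ => (hf x).continuousAt.continuousWithinAt) (fun x hx => by
      have h1 := (hf x).hasDerivWithinAt (s := Ici x)
      have h2 : (g (x + δ) - g x) / H δ * Complex.exp (-(x * w))
        + k x * (Complex.exp (-(x * w)) * -w) = 0 := by
        rw [hk x hx.1, hgadd x δ hx.1 hδ0.le]
        simp only [w]
        ring
      rwa [h2] at h1) t ⟨t.2, le_rfl⟩
  have hkt : k t = g t := hk t t.2
  simp only [hk _ le_rfl, hkt, hg0] at hconst
  simp only [g, Real.toNNReal_coe, Complex.ofReal_zero, zero_mul, neg_zero, Complex.exp_zero,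
    mul_one] at hconst
  rw [Complex.exp_neg] at hconst
  exact (mul_inv_eq_one₀ (Complex.exp_ne_zero _)).1 hconst

theorem charFun_map_eq_integral {Ω : Type*} [MeasurableSpace Ω] {P : Measure Ω} {X : Ω → ℝ}
    (hX : Measurable X) (u : ℝ) :
    charFun (P.map X) u = ∫ ω, Complex.exp (u * X ω * Complex.I) ∂P := by
  rw [charFun_apply_real, integral_map hX.aemeasurable (by fun_prop)]

namespace IsLevyProcess

section paths

variable {Ω : Type*} [MeasurableSpace Ω] {Y : ℝ≥0 → Ω → ℝ} {P : Measure Ω}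

/-- Left limits and right continuity bound paths on compact time intervals. -/
theorem exists_path_bound (hY : IsLevyProcess Y P) (T : ℝ≥0) (ω : Ω) :
    ∃ B : ℝ, 0 ≤ B ∧ ∀ t ≤ T, |Y t ω| ≤ B := by
  have h := (isCompact_Icc (a := (0 : ℝ≥0)) (b := T)).induction_on
    (p := fun s => ∃ B : ℝ, 0 ≤ B ∧ ∀ t ∈ s, |Y t ω| ≤ B) ⟨0, le_rfl, by simp⟩
    (fun s t hst ⟨B, hB, h⟩ => ⟨B, hB, fun x hx => h x (hst hx)⟩)
    (fun s t ⟨B, hB, h⟩ ⟨B', hB', h'⟩ => ⟨max B B', le_max_of_le_left hB, fun x hx =>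
      hx.elim (fun hx => (h x hx).trans (le_max_left _ _))
        fun hx => (h' x hx).trans (le_max_right _ _)⟩)
    (fun t _ => by
      obtain ⟨l, hl⟩ := hY.leftLimits ω t
      have h1 : ∀ᶠ s in 𝓝[<] t, |Y s ω| < |l| + 1 :=
        hl.abs.eventually_lt_const (lt_add_one _)
      have h2 : ∀ᶠ s in 𝓝[≥] t, |Y s ω| < |Y t ω| + 1 :=
        Tendsto.eventually_lt_const (lt_add_one _) (hY.rightContinuous ω t).abs
      have h3 : ∀ᶠ s in 𝓝 t, |Y s ω| ≤ max (|l| + 1) (|Y t ω| + 1) := by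
        rw [← nhdsLT_sup_nhdsGE, eventually_sup]
        exact ⟨h1.mono fun s hs => hs.le.trans (le_max_left _ _),
          h2.mono fun s hs => hs.le.trans (le_max_right _ _)⟩
      exact ⟨_, mem_nhdsWithin_of_mem_nhds h3, _, by positivity, fun s hs => hs⟩)
  obtain ⟨B, hB, h⟩ := h
  exact ⟨B, hB, fun t ht => h t ⟨zero_le, ht⟩⟩

end paths

variable {Ω : Type*} [MeasurableSpace Ω] {Y : ℝ≥0 → Ω → ℝ} {P : Measure Ω}
  [IsProbabilityMeasure P]

theorem charFun_add (hY : IsLevyProcess Y P) (s t : ℝ≥0) (u : ℝ) :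
    charFun (P.map (Y (s + t))) u = charFun (P.map (Y s)) u * charFun (P.map (Y t)) u := by
  have hind := hY.indepIncrements.indepFun_eval_sub (r := 0) (s := s) (t := s + t) zero_le
    le_self_add (Eventually.of_forall hY.zero)
  have h1 := hind.charFun_map_add_eq_mul (hY.measurable s).aemeasurable
    ((hY.measurable (s + t)).sub (hY.measurable s)).aemeasurable
  have h2 : Y s + (Y (s + t) - Y s) = Y (s + t) := add_sub_cancel _ _
  rw [h2] at h1
  have h3 := hY.stationaryIncrements s t
  rw [h1, Pi.mul_apply, ← h3]
  rfl

theorem charFun_zero_time (hY : IsLevyProcess Y P) (u : ℝ) : charFun (P.map (Y 0)) u = 1 := by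
  have : Y 0 = fun _ => 0 := funext hY.zero
  rw [this, Measure.map_const, measure_univ, one_smul, charFun_dirac]
  simp

/-- Right continuity of paths at time `0` suffices: for `s ≤ t`, `φ_t - φ_s = φ_s (φ_{t-s} - 1)`
with `|φ_s| ≤ 1`. -/
theorem continuous_charFun_time (hY : IsLevyProcess Y P) (u : ℝ) :
    Continuous fun t => charFun (P.map (Y t)) u := by
  have hprob : ∀ t, IsProbabilityMeasure (P.map (Y t)) := fun t =>
    Measure.isProbabilityMeasure_map (hY.measurable t).aemeasurable
  have h0 : Tendsto (fun t => charFun (P.map (Y t)) u) (𝓝 0) (𝓝 1) := by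
    rw [← hY.charFun_zero_time u]
    simp_rw [fun t => charFun_map_eq_integral (P := P) (hY.measurable t) u]
    refine tendsto_integral_filter_of_dominated_convergence (fun _ => (1 : ℝ))
      (Eventually.of_forall fun t => ?_) (Eventually.of_forall fun t => Eventually.of_forall
        fun ω => ?_) (integrable_const _) (Eventually.of_forall fun ω => ?_)
    · have := hY.measurable t
      exact Measurable.aestronglyMeasurable (by fun_prop)
    · rw [← Complex.ofReal_mul, Complex.norm_exp_ofReal_mul_I]
    · have h1 := hY.rightContinuous ω 0
      rw [ContinuousWithinAt, show Ici (0 : ℝ≥0) = univ from Ici_bot, nhdsWithin_univ] at h1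
      have hc : Continuous fun x : ℝ => Complex.exp (u * x * Complex.I) := by fun_prop
      exact (hc.tendsto _).comp h1
  have hdist : ∀ s t : ℝ≥0, s ≤ t →
      ‖charFun (P.map (Y t)) u - charFun (P.map (Y s)) u‖
        ≤ ‖charFun (P.map (Y (nndist t s))) u - 1‖ := by
    intro s t hst
    have h1 : t = s + nndist t s := by
      apply NNReal.eq
      rw [NNReal.coe_add, coe_nndist, NNReal.dist_eq, abs_of_nonneg (by simpa using hst)]
      ring
    have h2 := hY.charFun_add s (nndist t s) u
    rw [← h1] at h2
    rw [h2, ← mul_sub_one, norm_mul]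
    exact mul_le_of_le_one_left (norm_nonneg _) (norm_charFun_le_one u)
  rw [continuous_iff_continuousAt]
  intro s
  have h3 : Tendsto (fun t => ‖charFun (P.map (Y (nndist t s))) u - 1‖) (𝓝 s) (𝓝 0) := by
    have h4 : Tendsto (fun t => nndist t s) (𝓝 s) (𝓝 0) := by
      have : Continuous fun t => nndist t s := by fun_prop
      simpa using this.tendsto s
    simpa using ((h0.comp h4).sub_const 1).norm
  rw [ContinuousAt, tendsto_iff_norm_sub_tendsto_zero]
  refine squeeze_zero (fun _ => norm_nonneg _) (fun t => ?_) h3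
  rcases le_total s t with h | h
  · exact hdist s t h
  · rw [norm_sub_rev, nndist_comm]
    exact hdist t s h

/-- The Lévy exponent. -/
theorem exists_exponent (hY : IsLevyProcess Y P) : ∃ Ψ : ℝ → ℂ, Continuous Ψ ∧ Ψ 0 = 0 ∧
    ∀ (t : ℝ≥0) (u : ℝ), charFun (P.map (Y t)) u = Complex.exp (t * Ψ u) := by
  have hprob : ∀ t, IsProbabilityMeasure (P.map (Y t)) := fun t =>
    Measure.isProbabilityMeasure_map (hY.measurable t).aemeasurable
  choose Ψ hΨ using fun u => exists_eq_exp_of_map_add (hY.continuous_charFun_time u)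
    (hY.charFun_zero_time u) (fun s t => hY.charFun_add s t u)
  -- The exponents were chosen separately for each `u`. Integrating over time gives `Ψ = (φ_δ - 1) /
  -- K δ` where `K δ ≠ 0`, and this quotient is continuous in `u`, so no branch of the logarithm has
  -- to be selected.
  let K : ℝ → ℝ → ℂ := fun δ u => ∫ s in (0 : ℝ)..δ, charFun (P.map (Y s.toNNReal)) u
  have hK : ∀ δ : ℝ, 0 ≤ δ → ∀ u, K δ u * Ψ u = charFun (P.map (Y δ.toNNReal)) u - 1 := by
    intro δ hδ u
    have h1 : K δ u = ∫ s in (0 : ℝ)..δ, Complex.exp (s * Ψ u) := by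
      refine intervalIntegral.integral_congr fun s hs => ?_
      rw [uIcc_of_le hδ] at hs
      simp only [hΨ u, Real.coe_toNNReal s hs.1]
    rw [h1, intervalIntegral_exp_mul, hΨ u, Real.coe_toNNReal δ hδ]
  have hKc : ∀ δ, Continuous (K δ) := fun δ =>
    intervalIntegral.continuous_of_dominated_interval (bound := fun _ => 1)
      (fun u => ((hY.continuous_charFun_time u).comp
        continuous_real_toNNReal).aestronglyMeasurable)
      (fun u => Eventually.of_forall fun s _ => norm_charFun_le_one u) intervalIntegrable_const
      (Eventually.of_forall fun s _ => continuous_charFun)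
  refine ⟨Ψ, continuous_iff_continuousAt.2 fun u => ?_, ?_, fun t u => hΨ u t⟩
  · obtain ⟨δ, hδ, hδ0⟩ : ∃ δ : ℝ, K δ u ≠ 0 ∧ 0 < δ := by
      have hc := (hY.continuous_charFun_time u).comp continuous_real_toNNReal
      have h1 := (hc.integral_hasStrictDerivAt 0 0).hasDerivAt.eventually_ne (c := 0)
        (by simp [hY.charFun_zero_time u])
      exact ((h1.filter_mono (nhdsWithin_mono _ fun x (hx : x ∈ Ioi (0 : ℝ)) => ne_of_gt hx)).and
        (self_mem_nhdsWithin (s := Ioi (0 : ℝ)))).exists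
    have h2 : ∀ᶠ v in 𝓝 u, K δ v ≠ 0 := (hKc δ).continuousAt.eventually_ne hδ
    have h3 : ContinuousAt (fun v => (charFun (P.map (Y δ.toNNReal)) v - 1) / K δ v) u :=
      (continuous_charFun.continuousAt.sub continuousAt_const).div (hKc δ).continuousAt hδ
    refine h3.congr ?_
    filter_upwards [h2] with v hv
    rw [div_eq_iff hv, mul_comm]
    exact (hK δ hδ0.le v).symm
  · have h1 := hK 1 zero_le_one 0
    simpa [K] using h1

end IsLevyProcess

/-! ### Random integrals -/

/-- The largest `i` with `i / n < s`. -/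
noncomputable def gridIndex (n : ℕ) (s : ℝ) : ℕ := ⌈n * s⌉₊ - 1

theorem gridIndex_eq {n i : ℕ} (hn : 0 < n) {s : ℝ} (h1 : (i : ℝ) / n < s)
    (h2 : s ≤ (i + 1 : ℕ) / n) : gridIndex n s = i := by
  have hn' : (0 : ℝ) < n := Nat.cast_pos.2 hn
  have : ⌈n * s⌉₊ = i + 1 := by
    rw [Nat.ceil_eq_iff (Nat.succ_ne_zero _)]
    rw [div_lt_iff₀ hn'] at h1
    rw [le_div_iff₀ hn'] at h2
    exact ⟨by simpa [mul_comm] using h1, by linarith⟩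
  simp [gridIndex, this]

theorem gridIndex_lt {n : ℕ} (hn : 0 < n) {s : ℝ} (hs : 0 < s) : (gridIndex n s : ℝ) / n < s := by
  have hn' : (0 : ℝ) < n := Nat.cast_pos.2 hn
  have h1 : 0 < ⌈n * s⌉₊ := Nat.ceil_pos.2 (by positivity)
  have h2 : gridIndex n s < ⌈n * s⌉₊ := Nat.sub_lt h1 one_pos
  rw [div_lt_iff₀ hn', mul_comm]
  exact Nat.lt_ceil.1 h2

theorem le_gridIndex_succ {n : ℕ} (hn : 0 < n) {s : ℝ} :
    s ≤ (gridIndex n s + 1 : ℕ) / n := by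
  have hn' : (0 : ℝ) < n := Nat.cast_pos.2 hn
  rw [le_div_iff₀ hn', mul_comm]
  refine (Nat.le_ceil _).trans ?_
  exact_mod_cast (by rw [gridIndex]; omega : ⌈n * s⌉₊ ≤ gridIndex n s + 1)

theorem gridIndex_lt_of_le_one {n : ℕ} (hn : 0 < n) {s : ℝ} (hs : 0 < s) (hs1 : s ≤ 1) :
    gridIndex n s < n := by
  have hn' : (0 : ℝ) < n := Nat.cast_pos.2 hn
  have := (gridIndex_lt hn hs).trans_le hs1
  rw [div_lt_one hn'] at this
  exact_mod_cast this

theorem tendsto_gridIndex_div {s : ℝ} (hs : 0 < s) :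
    Tendsto (fun n : ℕ => (gridIndex n s : ℝ) / n) atTop (𝓝 s) := by
  have h1 : Tendsto (fun n : ℕ => s - (1 : ℝ) / n) atTop (𝓝 s) := by
    simpa using (tendsto_const_div_atTop_nhds_zero_nat (1 : ℝ)).const_sub s
  refine tendsto_of_tendsto_of_tendsto_of_le_of_le' h1 tendsto_const_nhds ?_ ?_
  · filter_upwards [eventually_gt_atTop 0] with n hn
    have := le_gridIndex_succ hn (s := s)
    push_cast at this
    rw [add_div] at this
    linarith
  · filter_upwards [eventually_gt_atTop 0] with n hn using (gridIndex_lt hn hs).le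

theorem tendsto_gridIndex_succ_div {s : ℝ} (hs : 0 < s) :
    Tendsto (fun n : ℕ => ((gridIndex n s + 1 : ℕ) : ℝ) / n) atTop (𝓝 s) := by
  have h := (tendsto_gridIndex_div hs).add (tendsto_const_div_atTop_nhds_zero_nat (1 : ℝ))
  rw [add_zero] at h
  refine h.congr fun n => ?_
  push_cast
  ring

theorem measurable_gridIndex (n : ℕ) : Measurable (gridIndex n) :=
  (measurable_from_nat (f := fun k : ℕ => k - 1)).comp
    (Nat.measurable_ceil.comp (measurable_const.mul measurable_id))

/-- Convergence of Riemann–Stieltjes sums against an integrable density. -/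
theorem tendsto_sum_intervalIntegral_smul {E : Type*} [NormedAddCommGroup E] [NormedSpace ℝ E]
    [CompleteSpace E] {p : ℝ → ℝ} (hp : IntervalIntegrable p volume 0 1) {c : ℕ → ℕ → E}
    {G : ℝ → E} {B : ℝ} (hB : ∀ n i, i < n → ‖c n i‖ ≤ B)
    (hc : ∀ s ∈ Ioc (0 : ℝ) 1, Tendsto (fun n => c n (gridIndex n s)) atTop (𝓝 (G s))) :
    Tendsto (fun n : ℕ => ∑ i ∈ Finset.range n,
      (∫ s in (i / n : ℝ)..((i + 1 : ℕ) / n : ℝ), p s) • c n i) atTop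
      (𝓝 (∫ s in (0 : ℝ)..1, p s • G s)) := by
  have huI : Ι (0 : ℝ) 1 = Ioc 0 1 := uIoc_of_le zero_le_one
  -- The sum is the integral of `p` times a step function, so dominated convergence applies even if
  -- `p` is unbounded near `0`.
  have h1 : Tendsto (fun n : ℕ => ∫ s in (0 : ℝ)..1, p s • c n (gridIndex n s)) atTop
      (𝓝 (∫ s in (0 : ℝ)..1, p s • G s)) := by
    refine intervalIntegral.tendsto_integral_filter_of_dominated_convergence
      (fun s => ‖p s‖ * B) (Eventually.of_forall fun n => ?_) ?_ (hp.norm.mul_const B)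
      (Eventually.of_forall fun s hs => ?_)
    · refine (intervalIntegrable_iff.1 hp).aestronglyMeasurable.smul ?_
      exact ((StronglyMeasurable.of_discrete (f := c n)).comp_measurable
        (measurable_gridIndex n)).aestronglyMeasurable
    · filter_upwards [eventually_gt_atTop 0] with n hn
      refine Eventually.of_forall fun s hs => ?_
      rw [huI] at hs
      rw [norm_smul]
      gcongr
      exact hB n _ (gridIndex_lt_of_le_one hn hs.1 hs.2)
    · rw [huI] at hs
      exact (hc s hs).const_smul (p s)
  refine h1.congr' ?_
  filter_upwards [eventually_gt_atTop 0] with n hn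
  have hn' : (0 : ℝ) < n := Nat.cast_pos.2 hn
  have hle : ∀ i : ℕ, (i / n : ℝ) ≤ ((i + 1 : ℕ) / n : ℝ) := fun i => by
    gcongr
    exact Nat.le_succ i
  have heq : ∀ i : ℕ, EqOn (fun s => p s • c n i) (fun s => p s • c n (gridIndex n s))
      (Ι (i / n : ℝ) ((i + 1 : ℕ) / n : ℝ)) := fun i s hs => by
    rw [uIoc_of_le (hle i)] at hs
    simp only [gridIndex_eq hn hs.1 hs.2]
  have hint : ∀ i < n, IntervalIntegrable p volume (i / n : ℝ) ((i + 1 : ℕ) / n : ℝ) := by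
    intro i hi
    refine hp.mono_set ?_
    rw [uIcc_of_le (hle i), uIcc_of_le zero_le_one]
    refine Icc_subset_Icc (by positivity) ?_
    rw [div_le_one hn']
    exact_mod_cast hi
  have h2 := intervalIntegral.sum_integral_adjacent_intervals (n := n)
    (f := fun s => p s • c n (gridIndex n s)) (μ := volume) (a := fun i : ℕ => (i / n : ℝ))
    (fun i hi => IntervalIntegrable.congr (heq i) (intervalIntegrable_iff.2
      ((intervalIntegrable_iff.1 (hint i hi)).smul_const (c n i))))
  simp only [Nat.cast_zero, zero_div, div_self hn'.ne'] at h2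
  rw [← h2]
  refine Finset.sum_congr rfl fun i hi => ?_
  rw [← intervalIntegral.integral_smul_const]
  exact (intervalIntegral.integral_congr_ae (Eventually.of_forall fun s hs => heq i hs)).symm

theorem sum_range_mul_sub (y : ℕ → ℝ) (n : ℕ) :
    ∑ i ∈ Finset.range n, (i : ℝ) * (y (i + 1) - y i)
      = n * y n - ∑ i ∈ Finset.range n, y (i + 1) := by
  induction n with
  | zero => simp
  | succ n ih =>
    rw [Finset.sum_range_succ, Finset.sum_range_succ, ih]
    push_cast
    ring

/-- Riemann sums approximating the random integral of the identity. -/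
noncomputable def identityRiemannSum (r : ℝ → ℝ) (Y : ℝ≥0 → Ω → ℝ) (n : ℕ) (ω : Ω) : ℝ :=
  ∑ i ∈ Finset.range n, (i / n : ℝ) *
    (Y (r ((i + 1 : ℕ) / n)).toNNReal ω - Y (r (i / n)).toNNReal ω)

theorem IsLevyProcess.measurable_identityRiemannSum {Ω : Type*} [MeasurableSpace Ω] {Y : ℝ≥0 → Ω → ℝ}
    {P : Measure Ω} {r : ℝ → ℝ} (hY : IsLevyProcess Y P) (n : ℕ) :
    Measurable (identityRiemannSum r Y n) :=
  Finset.measurable_sum _ fun _ _ =>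
    measurable_const.mul ((hY.measurable _).sub (hY.measurable _))

namespace IsLevyProcess

variable {Ω : Type*} [MeasurableSpace Ω] {Y : ℝ≥0 → Ω → ℝ} {P : Measure Ω}
  {p r : ℝ → ℝ}

/-- Summation by parts turns the sums into `Y(r 1)` minus right-endpoint Riemann sums of `Y ∘ r`.
Grid points approach `s` from the right and `r` is monotone, so right continuity of each path is
enough. -/
theorem tendsto_identityRiemannSum (hY : IsLevyProcess Y P) (hr : MonotoneOn r (Icc 0 1))
    (hrc : ContinuousOn r (Icc 0 1)) (ω : Ω) :
    Tendsto (fun n => identityRiemannSum r Y n ω) atTop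
      (𝓝 (randomIntegral (fun t => t) r 0 1 Y ω)) := by
  obtain ⟨B, hB0, hB⟩ := hY.exists_path_bound (r 1).toNNReal ω
  have h1 := tendsto_sum_intervalIntegral_smul (p := fun _ => (1 : ℝ))
    (c := fun n i => Y (r ((i + 1 : ℕ) / n)).toNNReal ω) (G := fun s => Y (r s).toNNReal ω)
    (B := B) intervalIntegrable_const (fun n i hi => ?_) (fun s hs => ?_)
  · have h2 : randomIntegral (fun t => t) r 0 1 Y ω
        = Y (r 1).toNNReal ω - ∫ s in (0 : ℝ)..1, (1 : ℝ) • Y (r s).toNNReal ω := by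
        simp [randomIntegral]
    rw [h2]
    refine (h1.const_sub _).congr' ?_
    filter_upwards [eventually_gt_atTop 0] with n hn
    have hn' : (n : ℝ) ≠ 0 := (Nat.cast_pos.2 hn).ne'
    have h3 := sum_range_mul_sub (fun i => Y (r (i / n)).toNNReal ω) n
    simp only [identityRiemannSum, div_mul_eq_mul_div, ← Finset.sum_div]
    rw [h3]
    simp only [intervalIntegral.integral_const, smul_eq_mul, mul_one, div_self hn']
    have h4 : ∀ i : ℕ, (((i + 1 : ℕ) / n : ℝ) - i / n) = (n : ℝ)⁻¹ := fun i => by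
      push_cast
      field_simp
      ring
    simp only [h4, ← Finset.mul_sum]
    field_simp
  · have hn' : (0 : ℝ) < n := Nat.cast_pos.2 (by omega)
    refine hB _ (Real.toNNReal_le_toNNReal (hr ⟨by positivity, ?_⟩ (by simp) ?_)) <;>
    · rw [div_le_one hn']
      exact_mod_cast hi
  · have hgrid : ∀ᶠ n : ℕ in atTop, ((gridIndex n s + 1 : ℕ) : ℝ) / n ∈ Icc s 1 := by
      filter_upwards [eventually_gt_atTop 0] with n hn
      refine ⟨le_gridIndex_succ hn, ?_⟩
      rw [div_le_one (Nat.cast_pos.2 hn)]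
      exact_mod_cast gridIndex_lt_of_le_one hn hs.1 hs.2
    have h5 : Tendsto (fun n : ℕ => r (((gridIndex n s + 1 : ℕ) : ℝ) / n)) atTop (𝓝 (r s)) := by
      refine Tendsto.comp (hrc s ⟨hs.1.le, hs.2⟩) ?_
      refine tendsto_nhdsWithin_iff.2 ⟨tendsto_gridIndex_succ_div hs.1, ?_⟩
      exact hgrid.mono fun n hn => ⟨hs.1.le.trans hn.1, hn.2⟩
    refine Tendsto.comp (hY.rightContinuous ω (r s).toNNReal) ?_
    refine tendsto_nhdsWithin_iff.2 ⟨(continuous_real_toNNReal.tendsto _).comp h5, ?_⟩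
    exact hgrid.mono fun n hn => Real.toNNReal_le_toNNReal
      (hr ⟨hs.1.le, hs.2⟩ ⟨hs.1.le.trans hn.1, hn.2⟩ hn.1)

/-- Increments over the grid are independent, and by stationarity each has exponent `(r((i+1)/n) -
r(i/n)) Ψ`. -/
theorem charFun_identityRiemannSum (hY : IsLevyProcess Y P) {Ψ : ℝ → ℂ}
    (hΨ : ∀ (t : ℝ≥0) (u : ℝ), charFun (P.map (Y t)) u = Complex.exp (t * Ψ u))
    (hr : MonotoneOn r (Icc 0 1)) (hr0 : 0 ≤ r 0) (n : ℕ) (u : ℝ) :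
    charFun (P.map (identityRiemannSum r Y n)) u = Complex.exp (∑ i ∈ Finset.range n,
      (r ((i + 1 : ℕ) / n) - r (i / n)) • Ψ (i / n * u)) := by
  have hmem : ∀ i ≤ n, (i / n : ℝ) ∈ Icc (0 : ℝ) 1 := fun i hi =>
    ⟨by positivity, div_le_one_of_le₀ (by exact_mod_cast hi) (by positivity)⟩
  have hmono : ∀ i j : ℕ, i ≤ j → j ≤ n → r (i / n) ≤ r (j / n) := fun i j hij hj =>
    hr (hmem i (hij.trans hj)) (hmem j hj) (by gcongr)
  have hpos : ∀ i ≤ n, 0 ≤ r (i / n) := fun i hi => by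
    have := hmono 0 i (Nat.zero_le _) hi
    rw [Nat.cast_zero, zero_div] at this
    exact hr0.trans this
  let D : Fin n → Ω → ℝ := fun i ω =>
    Y (r ((i + 1 : ℕ) / n)).toNNReal ω - Y (r ((i : ℕ) / n)).toNNReal ω
  have hD : ∀ i, Measurable (D i) := fun i => (hY.measurable _).sub (hY.measurable _)
  have hind : iIndepFun D P := by
    refine hY.indepIncrements n (fun i => (r ((i : ℕ) / n)).toNNReal) fun i j hij => ?_
    exact Real.toNNReal_le_toNNReal (hmono i j hij (Nat.lt_succ_iff.1 j.2))
  have hind' : iIndepFun (fun (i : Fin n) ω => ((i : ℕ) / n : ℝ) * D i ω) P :=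
    hind.comp (fun i x => ((i : ℕ) / n : ℝ) * x) fun i => measurable_const.mul measurable_id
  have h1 : identityRiemannSum r Y n = fun ω => ∑ i : Fin n, ((i : ℕ) / n : ℝ) * D i ω := by
    funext ω
    exact Finset.sum_range fun i : ℕ => (i / n : ℝ) *
      (Y (r ((i + 1 : ℕ) / n)).toNNReal ω - Y (r (i / n)).toNNReal ω)
  have h3 : ∀ i : Fin n, AEMeasurable (fun ω => ((i : ℕ) / n : ℝ) * D i ω) P := fun i =>
    (measurable_const.mul (hD i)).aemeasurable
  rw [h1, hind'.charFun_map_fun_sum_eq_prod h3, Finset.prod_apply, Finset.sum_range, Complex.exp_sum]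
  refine Finset.prod_congr rfl fun i _ => ?_
  rw [charFun_map_mul_comp (hD i).aemeasurable]
  have hle := hmono i (i + 1) (Nat.le_succ _) i.2
  have h2 := hY.stationaryIncrements (r ((i : ℕ) / n)).toNNReal
    (r ((i + 1 : ℕ) / n) - r ((i : ℕ) / n)).toNNReal
  rw [← Real.toNNReal_add (hpos i i.2.le) (sub_nonneg.2 hle), add_sub_cancel] at h2
  simp only [D]
  rw [h2, hΨ, Real.coe_toNNReal _ (sub_nonneg.2 hle), Complex.real_smul]

/-- The exponent of the random integral of the identity. -/
theorem charFun_randomIntegral [IsProbabilityMeasure P] (hY : IsLevyProcess Y P) {Ψ : ℝ → ℂ} (hΨc : Continuous Ψ)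
    (hΨ : ∀ (t : ℝ≥0) (u : ℝ), charFun (P.map (Y t)) u = Complex.exp (t * Ψ u))
    (hp0 : ∀ s ∈ Icc (0 : ℝ) 1, 0 ≤ p s) (hp : IntervalIntegrable p volume 0 1)
    (hr : ∀ t ∈ Icc (0 : ℝ) 1, r t = ∫ s in (0 : ℝ)..t, p s) :
    Measurable (randomIntegral (fun t => t) r 0 1 Y) ∧
      ∀ u, charFun (P.map (randomIntegral (fun t => t) r 0 1 Y)) u
        = Complex.exp (∫ s in (0 : ℝ)..1, p s • Ψ (s * u)) := by
  have hsub : ∀ {s t : ℝ}, s ∈ Icc (0 : ℝ) 1 → t ∈ Icc (0 : ℝ) 1 →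
      IntervalIntegrable p volume s t := fun hs ht =>
    hp.mono_set (by rw [uIcc_of_le zero_le_one]; exact uIcc_subset_Icc hs ht)
  have h0 : (0 : ℝ) ∈ Icc (0 : ℝ) 1 := by simp
  have hdiff : ∀ {s t : ℝ}, s ∈ Icc (0 : ℝ) 1 → t ∈ Icc (0 : ℝ) 1 →
      r t - r s = ∫ x in s..t, p x := fun {s t} hs ht => by
    rw [hr s hs, hr t ht]
    exact intervalIntegral.integral_interval_sub_left (hsub h0 ht) (hsub h0 hs)
  have hmono : MonotoneOn r (Icc 0 1) := fun s hs t ht hst => by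
    rw [← sub_nonneg, hdiff hs ht]
    exact intervalIntegral.integral_nonneg hst fun x hx =>
      hp0 x ⟨hs.1.trans hx.1, hx.2.trans ht.2⟩
  have hcont : ContinuousOn r (Icc 0 1) := by
    have := intervalIntegral.continuousOn_primitive_interval' (a := 0) hp (by simp)
    rw [uIcc_of_le zero_le_one] at this
    exact this.congr hr
  have hr0 : 0 ≤ r 0 := by rw [hr 0 h0, intervalIntegral.integral_same]
  have hlim := hY.tendsto_identityRiemannSum hmono hcont
  have hmeas : Measurable (randomIntegral (fun t => t) r 0 1 Y) :=
    measurable_of_tendsto_metrizable (fun n => hY.measurable_identityRiemannSum n)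
      (tendsto_pi_nhds.2 hlim)
  refine ⟨hmeas, fun u => ?_⟩
  have h1 : Tendsto (fun n => charFun (P.map (identityRiemannSum r Y n)) u) atTop
      (𝓝 (charFun (P.map (randomIntegral (fun t => t) r 0 1 Y)) u)) := by
    simp_rw [fun n => charFun_map_eq_integral (P := P) (hY.measurable_identityRiemannSum n
      (r := r)) u]
    rw [charFun_map_eq_integral hmeas]
    refine tendsto_integral_of_dominated_convergence (fun _ => (1 : ℝ)) (fun n => ?_)
      (integrable_const _) (fun n => Eventually.of_forall fun ω => ?_)
      (Eventually.of_forall fun ω => ?_)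
    · have := hY.measurable_identityRiemannSum n (r := r)
      exact Measurable.aestronglyMeasurable (by fun_prop)
    · rw [← Complex.ofReal_mul, Complex.norm_exp_ofReal_mul_I]
    · have hc : Continuous fun x : ℝ => Complex.exp (u * x * Complex.I) := by fun_prop
      exact (hc.tendsto _).comp (hlim ω)
  obtain ⟨B, hB⟩ := (isCompact_Icc (a := (0 : ℝ)) (b := 1)).exists_bound_of_continuousOn
    (f := fun s => Ψ (s * u)) (by fun_prop)
  have h2 := tendsto_sum_intervalIntegral_smul (c := fun n i => Ψ (i / n * u))
    (G := fun s => Ψ (s * u)) (B := B) hp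
    (fun n i hi => hB (i / n) ⟨by positivity, div_le_one_of_le₀ (by exact_mod_cast hi.le)
      (by positivity)⟩)
    (fun s hs => (hΨc.tendsto _).comp ((tendsto_gridIndex_div hs.1).mul_const u))
  refine tendsto_nhds_unique h1 (((Complex.continuous_exp.tendsto _).comp h2).congr' ?_)
  filter_upwards [eventually_gt_atTop 0] with n hn
  rw [hY.charFun_identityRiemannSum hΨ hmono hr0]
  simp only [Function.comp_apply]
  congr 1
  refine Finset.sum_congr rfl fun i hi => ?_
  have hi' := Finset.mem_range.1 hi
  rw [hdiff]
  · exact ⟨by positivity, div_le_one_of_le₀ (by exact_mod_cast hi'.le) (by positivity)⟩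
  · exact ⟨by positivity, div_le_one_of_le₀ (by exact_mod_cast hi') (by positivity)⟩

end IsLevyProcess

/-! ### Uniqueness of logarithms and of analytic continuations -/

/-- The difference is continuous with values in `2πiℤ`, so the set where the two agree is clopen and
contains `0`. -/
theorem IsLogCharFun.unique {ν : Measure ℝ} {ψ χ : ℝ → ℂ} (hψ : IsLogCharFun ν ψ)
    (hχ : IsLogCharFun ν χ) : ψ = χ := by
  obtain ⟨hψc, hψ0, hψ⟩ := hψ
  obtain ⟨hχc, hχ0, hχ⟩ := hχ
  have hd : Continuous fun t => ψ t - χ t := hψc.sub hχc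
  have hexp : ∀ t, Complex.exp (ψ t - χ t) = 1 := fun t => by
    rw [Complex.exp_sub, ← hψ, ← hχ, hχ, div_self (Complex.exp_ne_zero _)]
  have hsmall : ∀ t, ‖ψ t - χ t‖ < 2 * Real.pi → ψ t = χ t := by
    intro t ht
    obtain ⟨n, hn⟩ := Complex.exp_eq_one_iff.1 (hexp t)
    rw [← sub_eq_zero, hn]
    rw [hn, norm_mul, norm_mul, Complex.norm_I, mul_one, norm_mul, Complex.norm_ofNat,
      Complex.norm_real, Real.norm_of_nonneg Real.pi_pos.le, Complex.norm_intCast] at ht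
    have h1 : |(n : ℝ)| < 1 := by
      have := Real.two_pi_pos
      by_contra! h
      nlinarith
    have h2 : n = 0 := Int.abs_lt_one_iff.1 (by exact_mod_cast h1)
    simp [h2]
  have hclopen : IsClopen {t | ψ t = χ t} := by
    refine ⟨isClosed_eq hψc hχc, ?_⟩
    have : {t | ψ t = χ t} = {t | ‖ψ t - χ t‖ < 2 * Real.pi} := by
      ext t
      exact ⟨fun h => by
        have h' : ψ t = χ t := h
        simpa [h'] using Real.pi_pos, hsmall t⟩
    rw [this]
    exact isOpen_lt hd.norm continuous_const
  have := hclopen.eq_univ ⟨0, by simp [hψ0, hχ0]⟩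
  funext t
  exact (this.symm ▸ mem_univ t : t ∈ {t | ψ t = χ t})

theorem continuousOn_cauchyTransform_axis (ρ : Measure ℝ) [IsProbabilityMeasure ρ] :
    ContinuousOn (fun y : ℝ => ∫ x : ℝ, 1 / (Complex.I * y - (x : ℂ)) ∂ρ) (Ioi 0) := by
  intro y hy
  have hy0 : 0 < y := hy
  refine (continuousAt_of_dominated (bound := fun _ => (y / 2)⁻¹) ?_ ?_ (integrable_const _)
    (Eventually.of_forall fun x => ?_)).continuousWithinAt
  · filter_upwards [lt_mem_nhds hy0] with s hs
    exact (integrable_cauchyKernel ρ (by simpa using hs)).aestronglyMeasurable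
  · filter_upwards [lt_mem_nhds (half_lt_self hy0)] with s hs
    refine Eventually.of_forall fun x => ?_
    rw [norm_div, norm_one, one_div]
    refine inv_anti₀ (half_pos hy0) (hs.le.trans ?_)
    have := Complex.abs_im_le_norm (Complex.I * s - (x : ℂ))
    simp only [Complex.sub_im, Complex.mul_im, Complex.I_re, Complex.I_im, Complex.ofReal_re,
      Complex.ofReal_im, zero_mul, one_mul, zero_add, sub_zero] at this
    exact (le_abs_self s).trans this
  · refine ContinuousAt.div continuousAt_const (by fun_prop) ?_
    exact sub_ofReal_ne_zero (by simpa using hy0) x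

theorem norm_cauchyTransform_axis_le (ρ : Measure ℝ) [IsProbabilityMeasure ρ] {y : ℝ}
    (hy : 0 < y) : ‖∫ x : ℝ, 1 / (Complex.I * y - (x : ℂ)) ∂ρ‖ ≤ y⁻¹ := by
  have := norm_integral_le_of_norm_le_const (μ := ρ) (C := y⁻¹)
    (f := fun x : ℝ => 1 / (Complex.I * y - (x : ℂ))) (Eventually.of_forall fun x => by
      rw [norm_div, norm_one, one_div]
      refine inv_anti₀ hy ?_
      have := Complex.abs_im_le_norm (Complex.I * y - (x : ℂ))
      simp only [Complex.sub_im, Complex.mul_im, Complex.I_re, Complex.I_im, Complex.ofReal_re,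
        Complex.ofReal_im, zero_mul, one_mul, zero_add, sub_zero] at this
      exact (le_abs_self y).trans this)
  simpa using this

/-- Both continuations have prescribed values on the image under `F_ρ` of a vertical ray. This image
is connected and has more than one point, hence accumulates at each of its points, and the identity
theorem applies. -/
theorem IsImaginaryAxisTransform.eq {ρ : Measure ℝ} [IsProbabilityMeasure ρ] {f g : ℝ → ℂ}
    (hf : IsImaginaryAxisTransform ρ f) (hg : IsImaginaryAxisTransform ρ g) {t : ℝ} (ht : 0 < t) :
    f t = g t := by
  obtain ⟨V, hV, ⟨α, hα, β, hβ, hVρ⟩, hfV⟩ := hf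
  obtain ⟨W, hW, ⟨α', hα', β', hβ', hWρ⟩, hgW⟩ := hg
  have hopen : IsOpen {z : ℂ | 0 < z.im} := isOpen_lt continuous_const Complex.continuous_im
  have hIm : ∀ {y : ℝ}, 0 < y → 0 < (Complex.I * (y : ℂ)).im := fun hy => by simpa using hy
  set b := max β β' with hb
  have hb0 : 0 < b := lt_max_of_lt_left hβ
  let F : ℝ → ℂ := fun y => reciprocalCauchy ρ (Complex.I * y)
  let S : Set ℂ := F '' Ioi b
  have hcone : ∀ {y a c : ℝ}, 0 < a → c ≤ b → b < y → Complex.I * (y : ℂ) ∈ truncatedCone a c := by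
    intro y a c ha hc hy
    have : 0 < a * y := mul_pos ha (hb0.trans hy)
    simpa [truncatedCone, this] using hc.trans_lt hy
  have hEq : ∀ z ∈ S, V z = W z := by
    rintro _ ⟨y, hy, rfl⟩
    exact (hVρ _ (hcone hα (le_max_left _ _) hy)).trans
      (hWρ _ (hcone hα' (le_max_right _ _) hy)).symm
  have hFc : ContinuousOn F (Ioi b) :=
    ((continuousOn_cauchyTransform_axis ρ).mono (Ioi_subset_Ioi hb0.le)).inv₀
      fun y hy => cauchyTransform_ne_zero ρ (hIm (hb0.trans hy))
  have hSc : IsPreconnected S := isPreconnected_Ioi.image F hFc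
  have hy₁ : b < b + 1 := lt_add_one b
  -- Otherwise `G_ρ` would be constant on the ray, although it tends to `0` at infinity and never
  -- vanishes.
  have hnontriv : S.Nontrivial := by
    by_contra hS
    rw [not_nontrivial_iff] at hS
    have hG : ∀ y, b < y → ∫ x : ℝ, 1 / (Complex.I * y - (x : ℂ)) ∂ρ
        = ∫ x : ℝ, 1 / (Complex.I * (b + 1 : ℝ) - (x : ℂ)) ∂ρ := fun y hy =>
      inv_injective (hS ⟨y, hy, rfl⟩ ⟨b + 1, hy₁, rfl⟩)
    have h1 : ‖∫ x : ℝ, 1 / (Complex.I * (b + 1 : ℝ) - (x : ℂ)) ∂ρ‖ ≤ 0 := by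
      refine ge_of_tendsto tendsto_inv_atTop_zero ?_
      filter_upwards [eventually_gt_atTop b] with y hy
      rw [← hG y hy]
      exact norm_cauchyTransform_axis_le ρ (hb0.trans hy)
    exact cauchyTransform_ne_zero ρ (hIm (hb0.trans hy₁)) (norm_le_zero_iff.1 h1)
  have hz₀ : F (b + 1) ∈ S := ⟨b + 1, hy₁, rfl⟩
  have hacc := hSc.preperfect_of_nontrivial hnontriv _ hz₀
  have hfreq : ∃ᶠ z in 𝓝[≠] F (b + 1), V z = W z := by
    rw [frequently_nhdsWithin_iff]
    exact (accPt_iff_frequently.1 hacc).mono fun z hz => ⟨hEq z hz.2, hz.1⟩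
  have := AnalyticOnNhd.eqOn_of_preconnected_of_frequently_eq (hV.analyticOnNhd hopen)
    (hW.analyticOnNhd hopen) (convex_halfSpace_im_gt 0).isPreconnected
    (im_reciprocalCauchy_pos ρ (hIm (hb0.trans hy₁))) hfreq
  rw [hfV t ht, hgW t ht]
  exact this (hIm ht)

theorem IsImaginaryAxisTransform.congr {ρ : Measure ℝ} {f g : ℝ → ℂ}
    (hf : IsImaginaryAxisTransform ρ f) (h : ∀ t, 0 < t → g t = f t) :
    IsImaginaryAxisTransform ρ g := by
  obtain ⟨V, hV, hVρ, hfV⟩ := hf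
  exact ⟨V, hV, hVρ, fun t ht => (h t ht).trans (hfV t ht)⟩

theorem IsImaginaryAxisTransform.differentiableOn {ρ : Measure ℝ} {f : ℝ → ℂ}
    (hf : IsImaginaryAxisTransform ρ f) : DifferentiableOn ℝ f (Ioi 0) := by
  obtain ⟨V, hV, -, hfV⟩ := hf
  have hopen : IsOpen {z : ℂ | 0 < z.im} := isOpen_lt continuous_const Complex.continuous_im
  have h1 : DifferentiableOn ℝ (fun t : ℝ => V (Complex.I * t)) (Ioi 0) := by
    intro t ht
    have h2 : DifferentiableAt ℂ V (Complex.I * t) :=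
      hV.differentiableAt (hopen.mem_nhds (by simpa using ht))
    have h3 : HasDerivAt (fun s : ℝ => Complex.I * (s : ℂ)) Complex.I t := by
      simpa using (Complex.ofRealCLM.hasDerivAt (x := t)).const_mul Complex.I
    exact (h2.hasDerivAt.comp_of_eq t h3 rfl).differentiableAt.differentiableWithinAt
  exact h1.congr fun t ht => hfV t ht

/-! ### Averages and logarithmic weights -/

/-- The averaging operator `f ↦ ∫_0^1 f(s ·) ds`. -/
noncomputable def radialAverage (f : ℝ → ℂ) (u : ℝ) : ℂ := ∫ s in (0 : ℝ)..1, f (s * u)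

theorem continuous_radialAverage {f : ℝ → ℂ} (hf : Continuous f) : Continuous (radialAverage f) :=
  intervalIntegral.continuous_parametric_intervalIntegral_of_continuous'
    (f := fun u s => f (s * u)) (by fun_prop) 0 1

theorem mul_radialAverage (f : ℝ → ℂ) (u : ℝ) : (u : ℂ) * radialAverage f u = ∫ x in (0 : ℝ)..u, f x := by
  have := intervalIntegral.smul_integral_comp_mul_right (a := 0) (b := 1) f u
  rwa [zero_mul, one_mul, Complex.real_smul] at this

theorem hasDerivAt_mul_radialAverage {f : ℝ → ℂ} (hf : Continuous f) (u : ℝ) :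
    HasDerivAt (fun u : ℝ => (u : ℂ) * radialAverage f u) (f u) u := by
  simp_rw [mul_radialAverage]
  exact (hf.integral_hasStrictDerivAt 0 u).hasDerivAt

/-- The density `(-log s)^m / m!` of the time change `τ_{m+1}`. -/
noncomputable def logWeight (m : ℕ) (s : ℝ) : ℝ := (1 / (m.factorial : ℝ)) * (-Real.log s) ^ m

theorem tau_succ (m : ℕ) (t : ℝ) : tau (m + 1) t = ∫ s in (0 : ℝ)..t, logWeight m s := by
  simp only [tau, logWeight, Nat.add_sub_cancel, intervalIntegral.integral_const_mul]

theorem logWeight_nonneg (m : ℕ) {s : ℝ} (hs : s ∈ Icc (0 : ℝ) 1) : 0 ≤ logWeight m s := by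
  have := Real.log_nonpos hs.1 hs.2
  have h2 : 0 ≤ -Real.log s := by linarith
  rw [logWeight]
  positivity

/-- Raise `|log s| s^e ≤ 1/e` to the power `m`, with `e = 1/(2(m+1))`: then `me ≤ 1/2`, and `m + 1`
keeps `e` meaningful at `m = 0`. The bound gives integrability of the weight and the vanishing of
the boundary term at `0`. -/
theorem logWeight_mul_rpow_le (m : ℕ) {s : ℝ} (hs : 0 < s) (hs1 : s ≤ 1) :
    logWeight m s * s ^ (1 / 2 : ℝ) ≤ (2 * (m + 1)) ^ m := by
  have hlog := Real.log_nonpos hs.le hs1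
  have he : (0 : ℝ) < 1 / (2 * (m + 1)) := by positivity
  have h1 := (Real.abs_log_mul_self_rpow_lt s _ hs hs1 he).le
  rw [one_div_one_div, abs_mul, abs_of_nonpos hlog, abs_of_nonneg (by positivity)] at h1
  have h2 : s ^ (1 / 2 : ℝ) ≤ (s ^ (1 / (2 * (m + 1)) : ℝ)) ^ m := by
    rw [← Real.rpow_natCast, ← Real.rpow_mul hs.le]
    refine Real.rpow_le_rpow_of_exponent_ge hs hs1 ?_
    rw [div_mul_eq_mul_div, one_mul, div_le_div_iff₀ (by positivity) (by positivity)]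
    linarith
  have h3 : 0 ≤ -Real.log s := by linarith
  have h4 : (1 / (m.factorial : ℝ)) ≤ 1 := by
    rw [div_le_one (by positivity)]
    exact_mod_cast Nat.one_le_iff_ne_zero.2 m.factorial_ne_zero
  calc logWeight m s * s ^ (1 / 2 : ℝ)
      ≤ 1 * (-Real.log s) ^ m * (s ^ (1 / (2 * (m + 1)) : ℝ)) ^ m := by
        rw [logWeight]
        gcongr
    _ = (-Real.log s * s ^ (1 / (2 * (m + 1)) : ℝ)) ^ m := by rw [mul_pow, one_mul]
    _ ≤ _ := by gcongr

theorem measurable_logWeight (m : ℕ) : Measurable (logWeight m) := by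
  unfold logWeight
  fun_prop

theorem intervalIntegrable_logWeight (m : ℕ) : IntervalIntegrable (logWeight m) volume 0 1 := by
  have h1 := (intervalIntegral.intervalIntegrable_rpow' (a := 0) (b := 1)
    (r := -(1 / 2)) (by norm_num)).const_mul ((2 * (m + 1)) ^ m : ℝ)
  refine h1.mono_fun (measurable_logWeight m).aestronglyMeasurable ?_
  filter_upwards [ae_restrict_mem measurableSet_uIoc] with s hs
  rw [uIoc_of_le zero_le_one] at hs
  have hs0 := hs.1
  rw [Real.norm_of_nonneg (logWeight_nonneg m ⟨hs.1.le, hs.2⟩),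
    Real.norm_of_nonneg (by positivity), Real.rpow_neg hs.1.le, ← div_eq_mul_inv,
    le_div_iff₀ (by positivity)]
  exact logWeight_mul_rpow_le m hs.1 hs.2

theorem hasDerivAt_logWeight_succ (m : ℕ) {s : ℝ} (hs : 0 < s) :
    HasDerivAt (logWeight (m + 1)) (-(logWeight m s / s)) s := by
  have h1 := (((Real.hasDerivAt_log hs.ne').fun_neg).fun_pow (m + 1)).const_mul
    (1 / ((m + 1).factorial : ℝ))
  refine h1.congr_deriv ?_
  rw [logWeight, Nat.factorial_succ]
  have : (m.factorial : ℝ) ≠ 0 := Nat.cast_ne_zero.2 m.factorial_ne_zero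
  push_cast
  field_simp

/-- The exponent of `∫_{(0,1]} t dY(τ_{m+1}(t))`. -/
noncomputable def logWeightedAverage (m : ℕ) (Ψ : ℝ → ℂ) (u : ℝ) : ℂ :=
  ∫ s in (0 : ℝ)..1, logWeight m s • Ψ (s * u)

theorem logWeightedAverage_zero (Ψ : ℝ → ℂ) : logWeightedAverage 0 Ψ = radialAverage Ψ := by
  funext u
  simp [logWeightedAverage, radialAverage, logWeight]

/-- Integration by parts: the primitive `∫_0^s Ψ(xu) dx = s · AΨ(su)` supplies the factor `s` that
cancels the `1/s` in the derivative of the weight. -/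
theorem logWeightedAverage_succ (m : ℕ) {Ψ : ℝ → ℂ} (hΨ : Continuous Ψ) :
    logWeightedAverage (m + 1) Ψ = logWeightedAverage m (radialAverage Ψ) := by
  funext u
  have hf : Continuous fun s => Ψ (s * u) := by fun_prop
  let Q : ℝ → ℂ := fun s => s * radialAverage (fun s => Ψ (s * u)) s
  have hQ : ∀ s, Q s = s * radialAverage Ψ (s * u) := fun s => by
    simp only [Q, radialAverage, mul_assoc]
  have hQ' : ∀ s, HasDerivAt Q (Ψ (s * u)) s := fun s => hasDerivAt_mul_radialAverage hf s
  have hc1 : Continuous fun s => radialAverage Ψ (s * u) :=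
    (continuous_radialAverage hΨ).comp (by fun_prop)
  obtain ⟨B, hB⟩ := (isCompact_Icc (a := (0 : ℝ)) (b := 1)).exists_bound_of_continuousOn
    (f := fun s => radialAverage Ψ (s * u)) hc1.continuousOn
  have hB0 : 0 ≤ B := (norm_nonneg _).trans (hB 0 (by simp))
  have hderiv : ∀ s ∈ Ioo (0 : ℝ) 1, HasDerivAt (fun s => logWeight (m + 1) s • Q s)
      (logWeight (m + 1) s • Ψ (s * u) - logWeight m s • radialAverage Ψ (s * u)) s := by
    intro s hs
    refine ((hasDerivAt_logWeight_succ m hs.1).smul (hQ' s)).congr_deriv ?_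
    have hs0 : (s : ℂ) ≠ 0 := Complex.ofReal_ne_zero.2 hs.1.ne'
    rw [hQ]
    simp only [Complex.real_smul]
    push_cast
    field_simp
    ring
  -- This rests on the default `Real.log 0 = 0`; the product with `Q` really is continuous at `0`,
  -- since `Q(s) = O(s)` beats the logarithm.
  have hzero : logWeight (m + 1) 0 = 0 := by simp [logWeight]
  have hone : logWeight (m + 1) 1 = 0 := by simp [logWeight]
  have hcont : ContinuousOn (fun s => logWeight (m + 1) s • Q s) (Icc 0 1) := by
    intro s hs
    rcases hs.1.eq_or_lt with rfl | hs0
    · have h1 : Tendsto (fun s : ℝ => (2 * ((m + 1 : ℕ) + 1)) ^ (m + 1) * s ^ (1 / 2 : ℝ) * B)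
          (𝓝[Icc 0 1] 0) (𝓝 0) := by
        have : Continuous fun s : ℝ =>
            (2 * ((m + 1 : ℕ) + 1)) ^ (m + 1) * s ^ (1 / 2 : ℝ) * B :=
          (continuous_const.mul (Real.continuous_rpow_const (by norm_num))).mul continuous_const
        have h2 := this.tendsto 0
        rw [Real.zero_rpow (by norm_num), mul_zero, zero_mul] at h2
        exact h2.mono_left nhdsWithin_le_nhds
      rw [ContinuousWithinAt, hzero, zero_smul]
      refine squeeze_zero_norm' ?_ h1
      filter_upwards [self_mem_nhdsWithin] with x hx
      rcases hx.1.eq_or_lt with rfl | hx0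
      · rw [hzero, zero_smul, norm_zero]
        positivity
      · have hw := logWeight_nonneg (m + 1) hx
        rw [norm_smul, hQ, norm_mul, Complex.norm_real, Real.norm_of_nonneg hx.1,
          Real.norm_of_nonneg hw]
        have h3 : x = x ^ (1 / 2 : ℝ) * x ^ (1 / 2 : ℝ) := by
          rw [← Real.rpow_add hx0]
          norm_num
        calc logWeight (m + 1) x * (x * ‖radialAverage Ψ (x * u)‖)
            = (logWeight (m + 1) x * x ^ (1 / 2 : ℝ)) * x ^ (1 / 2 : ℝ)
              * ‖radialAverage Ψ (x * u)‖ := by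
              conv_lhs => rw [show logWeight (m + 1) x * (x * ‖radialAverage Ψ (x * u)‖)
                = logWeight (m + 1) x * x * ‖radialAverage Ψ (x * u)‖ by ring]
              conv_lhs => enter [1, 2]; rw [h3]
              ring
          _ ≤ _ := by
              gcongr
              · exact logWeight_mul_rpow_le (m + 1) hx0 hx.2
              · exact hB x hx
    · exact ((hasDerivAt_logWeight_succ m hs0).continuousAt.smul
        (hQ' s).continuousAt).continuousWithinAt
  have hi1 : IntervalIntegrable (fun s => logWeight (m + 1) s • Ψ (s * u)) volume 0 1 :=
    (intervalIntegrable_logWeight (m + 1)).smul_continuousOn hf.continuousOn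
  have hi2 : IntervalIntegrable (fun s => logWeight m s • radialAverage Ψ (s * u)) volume 0 1 :=
    (intervalIntegrable_logWeight m).smul_continuousOn hc1.continuousOn
  have h := intervalIntegral.integral_eq_sub_of_hasDeriv_right_of_le zero_le_one hcont
    (fun s hs => (hderiv s hs).hasDerivWithinAt) (hi1.sub hi2)
  rw [hzero, hone, zero_smul, zero_smul, sub_zero, intervalIntegral.integral_sub hi1 hi2,
    sub_eq_zero] at h
  exact h

theorem logWeightedAverage_eq_iterate (m : ℕ) {Ψ : ℝ → ℂ} (hΨ : Continuous Ψ) :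
    logWeightedAverage m Ψ = radialAverage^[m + 1] Ψ := by
  induction m generalizing Ψ with
  | zero => exact logWeightedAverage_zero Ψ
  | succ m ih =>
    rw [logWeightedAverage_succ m hΨ, ih (continuous_radialAverage hΨ), ← Function.iterate_succ_apply]

/-- Integration by parts adds an average on the inside; passing through iterates moves it to the
outside, where `𝔻` can remove it. -/
theorem logWeightedAverage_succ_eq_radialAverage (m : ℕ) {Ψ : ℝ → ℂ} (hΨ : Continuous Ψ) :
    logWeightedAverage (m + 1) Ψ = radialAverage (logWeightedAverage m Ψ) := by
  rw [logWeightedAverage_eq_iterate _ hΨ, logWeightedAverage_eq_iterate _ hΨ,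
    Function.iterate_succ_apply']

theorem continuous_logWeightedAverage (m : ℕ) {Ψ : ℝ → ℂ} (hΨ : Continuous Ψ) :
    Continuous (logWeightedAverage m Ψ) := by
  cases m with
  | zero =>
    rw [logWeightedAverage_zero]
    exact continuous_radialAverage hΨ
  | succ m =>
    rw [logWeightedAverage_succ_eq_radialAverage m hΨ]
    exact continuous_radialAverage (continuous_logWeightedAverage m hΨ)

/-! ### The operator `𝔻` -/

/-- `𝔻` inverts averaging of exponents. -/
theorem two_mul_voiculescu_radialAverage_sub {χ : ℝ → ℂ} (hχ : IsInfDivExponent χ)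
    (hA : IsInfDivExponent (radialAverage χ)) {z : ℂ} (hz : 0 < z.im) :
    2 * voiculescuOfExponent (radialAverage χ) z - z * deriv (voiculescuOfExponent (radialAverage χ)) z
      = voiculescuOfExponent χ z := by
  obtain ⟨C, hC0, hC⟩ := hχ.exists_norm_le
  obtain ⟨C', hC'0, hC'⟩ := hA.exists_norm_le
  have hC1 : ∀ u, ‖χ (-u)‖ ≤ C * (1 + u ^ 2) := fun u => by simpa using hC (-u)
  have hC2 : ∀ u, ‖radialAverage χ (-u)‖ ≤ C' * (1 + u ^ 2) := fun u => by simpa using hC' (-u)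
  obtain ⟨hint, hderiv⟩ := hasDerivAt_laplace hA.continuous_comp_neg hC2 hz
  have hint0 := integrableOn_mul_exp hχ.continuous_comp_neg hC1 hz
  set L := ∫ u in Ioi (0 : ℝ), radialAverage χ (-u) * Complex.exp (Complex.I * z * u) with hL
  set L' := ∫ u in Ioi (0 : ℝ), radialAverage χ (-u) * (Complex.exp (Complex.I * z * u)
    * (Complex.I * u)) with hL'
  -- This function vanishes at `0` and at infinity, so its derivative has integral zero: `∫ χ(-u)
  -- e^{izu} du = -z L'`. In `2V - zV'` the terms with `L` cancel and `i z³ L'` remains.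
  have hG : ∀ u : ℝ, HasDerivAt (fun u : ℝ => (u * radialAverage χ (-u))
      * Complex.exp (Complex.I * z * u))
      (χ (-u) * Complex.exp (Complex.I * z * u)
        + z * (radialAverage χ (-u) * (Complex.exp (Complex.I * z * u) * (Complex.I * u)))) u := by
    intro u
    have h1 : HasDerivAt (fun u : ℝ => (u : ℂ) * radialAverage χ (-u)) (χ (-u)) u := by
      have h2 := ((hasDerivAt_mul_radialAverage hχ.continuous (-u)).scomp u (hasDerivAt_neg u)).fun_neg
      simpa [Function.comp_def] using h2
    have h3 : HasDerivAt (fun u : ℝ => Complex.exp (Complex.I * z * u))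
        (Complex.exp (Complex.I * z * u) * (Complex.I * z)) u := by
      have h4 : HasDerivAt (fun u : ℝ => Complex.I * z * (u : ℂ)) (Complex.I * z) u := by
        simpa using (Complex.ofRealCLM.hasDerivAt (x := u)).const_mul (Complex.I * z)
      exact h4.cexp
    refine (h1.mul h3).congr_deriv ?_
    ring
  have hintG : IntegrableOn (fun u : ℝ => (u * radialAverage χ (-u))
      * Complex.exp (Complex.I * z * u)) (Ioi 0) := by
    refine IntegrableOn.congr_fun (hint.const_mul (-Complex.I)) (fun u _ => ?_)
      measurableSet_Ioi
    linear_combination (-(u : ℂ) * radialAverage χ (-u) * Complex.exp (Complex.I * z * u))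
      * Complex.I_mul_I
  have hint' := hint0.add (hint.const_mul z)
  have hkey := integral_Ioi_of_hasDerivAt_of_tendsto
    (hG 0).continuousAt.continuousWithinAt (fun u _ => hG u) hint'
    (tendsto_zero_of_hasDerivAt_of_integrableOn_Ioi (fun u _ => hG u) hint' hintG)
  rw [integral_add hint0 (hint.const_mul z), integral_const_mul, ← hL'] at hkey
  simp only [Complex.ofReal_zero, zero_mul, sub_zero] at hkey
  have hV : HasDerivAt (voiculescuOfExponent (radialAverage χ))
      (-Complex.I * (2 * z) * L + -Complex.I * z ^ 2 * L') z := by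
    have h5 : HasDerivAt (fun z : ℂ => -Complex.I * z ^ 2) (-Complex.I * (2 * z)) z := by
      simpa using (hasDerivAt_pow 2 z).const_mul (-Complex.I)
    exact h5.mul hderiv
  rw [hV.deriv, voiculescuOfExponent, voiculescuOfExponent, ← hL]
  linear_combination (Complex.I * z ^ 2) * hkey

theorem opD_congr {f g : ℝ → ℂ} (h : ∀ t, 0 < t → f t = g t) {t : ℝ} (ht : 0 < t) :
    opD f t = opD g t := by
  have h1 : f =ᶠ[𝓝 t] g := by
    filter_upwards [lt_mem_nhds ht] with s hs using h s hs
  rw [opD, opD, h t ht, h1.deriv_eq]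

theorem opD_voiculescu_radialAverage {χ : ℝ → ℂ} (hχ : IsInfDivExponent χ)
    (hA : IsInfDivExponent (radialAverage χ)) {t : ℝ} (ht : 0 < t) :
    opD (fun t => voiculescuOfExponent (radialAverage χ) (Complex.I * t)) t
      = voiculescuOfExponent χ (Complex.I * t) := by
  have hz : 0 < (Complex.I * (t : ℂ)).im := by simpa using ht
  have hopen : IsOpen {z : ℂ | 0 < z.im} := isOpen_lt continuous_const Complex.continuous_im
  have h2 := (hA.differentiableOn_voiculescu.differentiableAt (hopen.mem_nhds hz)).hasDerivAt
  have h3 : HasDerivAt (fun s : ℝ => Complex.I * (s : ℂ)) Complex.I t := by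
    simpa using (Complex.ofRealCLM.hasDerivAt (x := t)).const_mul Complex.I
  have h4 := h2.comp_of_eq t h3 rfl
  rw [← two_mul_voiculescu_radialAverage_sub hχ hA hz, opD]
  have h5 : deriv (fun s : ℝ => voiculescuOfExponent (radialAverage χ) (Complex.I * s)) t
    = deriv (voiculescuOfExponent (radialAverage χ)) (Complex.I * t) * Complex.I := h4.deriv
  rw [h5]
  ring

/-! ### Exponents of the classes `𝒰^{<k>}` -/

namespace IsLevyProcess

variable {Ω : Type*} [MeasurableSpace Ω] {Y : ℝ≥0 → Ω → ℝ} {P : Measure Ω}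
  [IsProbabilityMeasure P] {Ψ : ℝ → ℂ}

theorem isInfDivExponent (hY : IsLevyProcess Y P) (hΨc : Continuous Ψ) (hΨ0 : Ψ 0 = 0)
    (hΨ : ∀ (t : ℝ≥0) (u : ℝ), charFun (P.map (Y t)) u = Complex.exp (t * Ψ u)) :
    IsInfDivExponent Ψ where
  continuous := hΨc
  zero := hΨ0
  root n _ := by
    refine ⟨P.map (Y (n : ℝ≥0)⁻¹), Measure.isProbabilityMeasure_map (hY.measurable _).aemeasurable,
      fun u => ?_⟩
    rw [hΨ]
    congr 1
    push_cast
    ring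

theorem isLogCharFun_logWeightedAverage (hY : IsLevyProcess Y P) (hΨc : Continuous Ψ)
    (hΨ0 : Ψ 0 = 0)
    (hΨ : ∀ (t : ℝ≥0) (u : ℝ), charFun (P.map (Y t)) u = Complex.exp (t * Ψ u)) (m : ℕ) :
    IsLogCharFun (P.map (randomIntegral (fun t => t) (tau (m + 1)) 0 1 Y))
      (logWeightedAverage m Ψ) :=
  ⟨continuous_logWeightedAverage m hΨc, by simp [logWeightedAverage, hΨ0],
    (hY.charFun_randomIntegral hΨc hΨ (fun _ hs => logWeight_nonneg m hs)
      (intervalIntegrable_logWeight m) fun t _ => tau_succ m t).2⟩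

/-- Slowing the clock to `τ_{m+1} / n` divides the exponent by `n`, so the `n`-th root is again the
law of a random integral of `Y`. -/
theorem isInfDivExponent_logWeightedAverage (hY : IsLevyProcess Y P) (hΨc : Continuous Ψ)
    (hΨ0 : Ψ 0 = 0)
    (hΨ : ∀ (t : ℝ≥0) (u : ℝ), charFun (P.map (Y t)) u = Complex.exp (t * Ψ u)) (m : ℕ) :
    IsInfDivExponent (logWeightedAverage m Ψ) where
  continuous := continuous_logWeightedAverage m hΨc
  zero := by simp [logWeightedAverage, hΨ0]
  root n _ := by
    obtain ⟨hm, hc⟩ := hY.charFun_randomIntegral (p := fun s => logWeight m s / n)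
      (r := fun t => tau (m + 1) t / n) hΨc hΨ
      (fun _ hs => div_nonneg (logWeight_nonneg m hs) n.cast_nonneg)
      ((intervalIntegrable_logWeight m).div_const _)
      (fun t _ => by rw [tau_succ, intervalIntegral.integral_div])
    refine ⟨P.map (randomIntegral (fun t => t) (fun t => tau (m + 1) t / n) 0 1 Y),
      Measure.isProbabilityMeasure_map hm.aemeasurable, fun u => ?_⟩
    rw [hc, logWeightedAverage, ← intervalIntegral.integral_div]
    congr 2
    funext s
    rw [Complex.real_smul, Complex.real_smul]
    push_cast
    ring

end IsLevyProcess

/-! ### The mapping property of `𝔻` -/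

theorem exists_axisTransform_eq {k : ℕ} {f : ℝ → ℂ} (hf : f ∈ freeU k) :
    ∃ ρ : Measure ℝ, IsImaginaryAxisTransform ρ f := by
  cases k with
  | zero =>
    obtain ⟨ρ, -, h⟩ := hf
    exact ⟨ρ, h⟩
  | succ k =>
    obtain ⟨-, -, ρ, -, h⟩ := hf
    exact ⟨ρ, h⟩

theorem opD_mem_freeU {k : ℕ} {f : ℝ → ℂ} (hf : f ∈ freeU (k + 1)) : opD f ∈ freeU k := by
  obtain ⟨ν, ⟨Ω, mΩ, P, hP, Y, hY, rfl⟩, ρ, ⟨⟨hρ, -⟩, ψ, hψ, hρψ⟩, hρf⟩ := hf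
  obtain ⟨Ψ, hΨc, hΨ0, hΨ⟩ := hY.exists_exponent
  have hlog := hY.isLogCharFun_logWeightedAverage hΨc hΨ0 hΨ
  obtain rfl := hψ.unique (hlog k)
  have hexp := hY.isInfDivExponent_logWeightedAverage hΨc hΨ0 hΨ
  -- Here `χ` is the exponent with one average removed: `Ψ` itself at the bottom level,
  -- `logWeightedAverage` of one order less above it.
  have hopD : ∀ {χ : ℝ → ℂ}, IsInfDivExponent χ → logWeightedAverage k Ψ = radialAverage χ →
      ∀ t : ℝ, 0 < t → opD f t = Complex.I * (t : ℂ) ^ 2 *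
        ∫ u in Ioi (0 : ℝ), χ (-u) * Complex.exp (-(t * u : ℂ)) := by
    intro χ hχ hk t ht
    have h1 : ∀ s : ℝ, 0 < s → f s = voiculescuOfExponent (radialAverage χ) (Complex.I * s) := by
      intro s hs
      rw [← hk, voiculescuOfExponent_I_mul]
      exact hρf.eq hρψ hs
    rw [opD_congr h1 ht, opD_voiculescu_radialAverage hχ (hk ▸ hexp k) ht, voiculescuOfExponent_I_mul]
  cases k with
  | zero =>
    have hχ := hY.isInfDivExponent hΨc hΨ0 hΨ
    obtain ⟨μ, hμ, hμt⟩ := hχ.exists_isFreelyInfDiv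
    exact ⟨μ, hμ, hμt.congr (hopD hχ (logWeightedAverage_zero Ψ))⟩
  | succ k =>
    obtain ⟨μ, hμ, hμt⟩ := (hexp k).exists_isFreelyInfDiv
    -- The same process `Y` serves one level down; only the time change is different.
    exact ⟨_, ⟨Ω, mΩ, P, hP, Y, hY, rfl⟩, μ, ⟨hμ, _, hlog k, hμt⟩,
      hμt.congr (hopD (hexp k) (logWeightedAverage_succ_eq_radialAverage k hΨc))⟩

theorem corollary1 :
    (∀ k : ℕ, 1 ≤ k →
      (∀ f ∈ freeU k, DifferentiableOn ℝ f (Ioi 0)) ∧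
      MapsTo opD (freeU k) (freeU (k - 1))) ∧
    (∀ k : ℕ, 1 ≤ k → MapsTo (opD^[k]) (freeU k) freeID) := by
  have hstep : ∀ k, MapsTo opD (freeU (k + 1)) (freeU k) := fun k f hf => opD_mem_freeU hf
  have hiter : ∀ k, MapsTo (opD^[k]) (freeU k) freeID := by
    intro k
    induction k with
    | zero => exact fun f hf => hf
    | succ k ih => exact fun f hf => ih (hstep k hf)
  refine ⟨fun k hk => ⟨fun f hf => ?_, ?_⟩, fun k _ => hiter k⟩
  · obtain ⟨ρ, h⟩ := exists_axisTransform_eq hf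
    exact h.differentiableOn
  · obtain ⟨k, rfl⟩ := Nat.exists_eq_add_of_le' hk
    exact hstep k
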